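/- All graphs are finite and simple. A graph $G$ has a $K_s$ minor if $V(G)$ contains $s$ pairwise disjoint sets, each inducing a connected (nonempty) subgraph of $G$, any two of which are joined by an edge of $G$. The star-arboricity of $G$ is the smallest integer $m\ge 0$ such that $E(G)$ can be decomposed into $m$ star forests, i.e. forests in which each component has diameter at most $2$. For an integer $s$, let $\ell(s)$ be the largest star-arboricity of a graph with no $K_s$ minor (with $\ell(s)=0$ for $s\le 0$, where there is no such graph). A spanning forest of $G$ is a maximal acyclic subgraph $T$ of $G$; the fundamental cut of $T$ with respect to an edge $f=xy$ of $T$ is the set of all edges of $G$ that join the component of $T-f$ containing $x$ to the component of $T-f$ containing $y$. **Theorem 1.5.** Let $t\ge 0$ be an integer. Then $\ell(t-1)$ is finite, and there exists an integer $k\le 16\,\ell(t-1)+1$ with the following property. If $G$ is a graph with no $K_t$ minor and $T$ is a spanning forest of $G$, then there exists a coloring $\varphi : E(G)\setminus E(T)\to\{1,\dots,k\}$ such that for each $f\in E(T)$ that is not a bridge of $G$, there exists a color $i\in\{1,\dots,k\}$ which occurs an odd number of times on the fundamental cut of $T$ with respect to $f$ (that is, the number of edges of color $i$ in this cut is odd).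 -/

import Mathlib

/-- `H` is a minor of `G`: there are pairwise disjoint, connected (in particular nonempty) branch
sets in `G`, one for each vertex of `H`, such that the branch sets of any two adjacent vertices
of `H` are joined by an edge of `G`. -/
def IsGraphMinor {W V : Type*} (H : SimpleGraph W) (G : SimpleGraph V) : Prop :=
  ∃ B : W → Set V,
    (∀ w, (G.induce (B w)).Connected) ∧
    (∀ w w', w ≠ w' → Disjoint (B w) (B w')) ∧
    (∀ w w', H.Adj w w' → ∃ x ∈ B w, ∃ y ∈ B w', G.Adj x y)

/-- `G` has the complete graph on `t` vertices as a minor. -/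
def HasCliqueMinor {V : Type*} (G : SimpleGraph V) (t : ℕ) : Prop :=
  IsGraphMinor (⊤ : SimpleGraph (Fin t)) G

/-- A star forest: a forest in which each component has diameter at most `2`. -/
def IsStarForest {V : Type*} (F : SimpleGraph V) : Prop :=
  F.IsAcyclic ∧ ∀ u v, F.Reachable u v → F.dist u v ≤ 2

/-- The edge set of `G` can be decomposed into (the edge sets of) `m` star forests. -/
def HasStarDecomposition {V : Type*} (G : SimpleGraph V) (m : ℕ) : Prop :=
  ∃ F : Fin m → SimpleGraph V,
    (∀ i, IsStarForest (F i)) ∧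
    (∀ i j, i ≠ j → Disjoint (F i).edgeSet (F j).edgeSet) ∧
    ⋃ i, (F i).edgeSet = G.edgeSet

/-- The star-arboricity of a (finite) graph. -/
noncomputable def starArboricity {V : Type*} (G : SimpleGraph V) : ℕ :=
  sInf {m | HasStarDecomposition G m}

/-- The star-arboricities of all finite graphs without a `K_s` minor (up to isomorphism, the
finite graphs are the graphs on the vertex sets `Fin n`). -/
def starArboricityValues (s : ℕ) : Set ℕ :=
  {a | ∃ (n : ℕ) (G : SimpleGraph (Fin n)), ¬ HasCliqueMinor G s ∧ starArboricity G = a}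

/-- The largest star-arboricity of a finite graph without a `K_s` minor. This is the maximum of
the set if the set is nonempty and bounded, and `0` if the set is empty. -/
noncomputable def maxStarArboricity (s : ℕ) : ℕ :=
  sSup (starArboricityValues s)

/-- A spanning forest of `G`: a maximal acyclic subgraph of `G`. -/
def IsSpanningForest {V : Type*} (G T : SimpleGraph V) : Prop :=
  Maximal (fun F : SimpleGraph V => F ≤ G ∧ F.IsAcyclic) T

/-- The fundamental cut of the forest `T` of `G` with respect to the edge `f = xy` of `T`: all
edges of `G` that join the component of `x` to the component of `y` in `T - f`. -/
def fundamentalCut {V : Type*} (G T : SimpleGraph V) (f : Sym2 V) : Set (Sym2 V) :=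
  {e | e ∈ G.edgeSet ∧ ∃ x y u v : V, f = s(x, y) ∧ e = s(u, v) ∧
    (T.deleteEdges {f}).Reachable x u ∧ (T.deleteEdges {f}).Reachable y v}

/-! Sixteen colours suffice for every finite graph, because of flows. Let `φ` be a flow with values
in `(ℤ/2)⁴` that is nonzero on every non-bridge, and colour each non-forest edge by its value. Flow
values sum to zero over any cut, and `f` is the only forest edge in its fundamental cut. If every
colour were even there, the non-forest edges would contribute zero, forcing `φ f = 0`; so `f` would
be a bridge.

Such a flow comes from `exists_flow_pair`, an argument in the spirit of Seymour's 6-flow theorem. A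
set `A` is grown until it is the whole vertex set, and two `(ℤ/2)²`-flows are built so that each
edge not inside `A` is nonzero in one of them. The step attaches to `A` a connected flow support
found in a minimal set `B` with at most one exit. The first flow covers that support; the second is
corrected along closed walks through it and `A` to cover the remaining new edges.

The bound `16 ≤ 16ℓ(t-1) + 1` needs `ℓ(t-1) ≥ 1`, which holds for `t ≥ 4` because of a single edge.
For `t ≤ 3` every edge is a bridge, since a cycle gives a `K₃` minor, and one colour does.

Finiteness of `ℓ` comes from Mader's contraction argument: excluding a complete minor bounds the
degeneracy by some `D`, and a `D`-colouring combined with `D` out-neighbour functions splits the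
edges into `D²` star forests. -/

section OddCutColoring

open Finset

/-! ### Flows in characteristic two -/

/-- A flow on `G` with values in a group of exponent two: a symmetric function on pairs of
vertices that is supported on the edges of `G` and sums to zero around each vertex. -/
structure IsFlow {V Γ : Type*} [Fintype V] [AddCommGroup Γ] (G : SimpleGraph V)
    (φ : V → V → Γ) : Prop where
  symm : ∀ u v, φ u v = φ v u
  supp : ∀ u v, φ u v ≠ 0 → G.Adj u v
  sum_eq_zero : ∀ u, ∑ v, φ u v = 0

namespace IsFlow

variable {V Γ : Type*} [Fintype V] [AddCommGroup Γ] {G H : SimpleGraph V} {φ χ : V → V → Γ}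

theorem zero (G : SimpleGraph V) : IsFlow G (fun _ _ => (0 : Γ)) :=
  ⟨fun _ _ => rfl, fun _ _ h => absurd rfl h, fun _ => by simp⟩

theorem add (hφ : IsFlow G φ) (hχ : IsFlow G χ) : IsFlow G (fun u v => φ u v + χ u v) where
  symm u v := by rw [hφ.symm, hχ.symm]
  supp u v h := by
    by_contra hn
    have h1 : φ u v = 0 := by_contra fun h' => hn (hφ.supp _ _ h')
    have h2 : χ u v = 0 := by_contra fun h' => hn (hχ.supp _ _ h')
    exact h (by rw [h1, h2, add_zero])
  sum_eq_zero u := by rw [sum_add_distrib, hφ.sum_eq_zero, hχ.sum_eq_zero, add_zero]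

theorem sum {ι : Type*} (s : Finset ι) {f : ι → V → V → Γ} (h : ∀ i ∈ s, IsFlow G (f i)) :
    IsFlow G (fun u v => ∑ i ∈ s, f i u v) := by
  classical
  induction s using Finset.induction_on with
  | empty => simpa using IsFlow.zero (Γ := Γ) G
  | insert a s ha ih =>
    have := (h a (mem_insert_self a s)).add (ih fun i hi => h i (mem_insert_of_mem hi))
    simpa [sum_insert ha] using this

theorem smul_const [Module (ZMod 2) Γ] {χ : V → V → ZMod 2} (hχ : IsFlow G χ) (γ : Γ) :
    IsFlow G (fun u v => χ u v • γ) where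
  symm u v := by rw [hχ.symm]
  supp u v h := hχ.supp u v fun h' => h (by rw [h', zero_smul])
  sum_eq_zero u := by rw [← sum_smul, hχ.sum_eq_zero, zero_smul]

theorem mono (hφ : IsFlow G φ) (h : G ≤ H) : IsFlow H φ :=
  ⟨hφ.symm, fun u v hn => h (hφ.supp u v hn), hφ.sum_eq_zero⟩

/-- The values of a flow on the edges leaving a set of vertices sum to zero. -/
theorem sum_cut_eq_zero [DecidableEq V] [Module (ZMod 2) Γ] (hφ : IsFlow G φ) (S : Finset V) :
    ∑ p ∈ S ×ˢ Sᶜ, φ p.1 p.2 = 0 := by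
  have h1 : ∑ u ∈ S, ∑ v, φ u v = 0 := Finset.sum_eq_zero fun u _ => hφ.sum_eq_zero u
  -- An edge inside `S` is counted once in each direction, and the two terms cancel.
  have h2 : ∑ p ∈ S ×ˢ S, φ p.1 p.2 = 0 := by
    refine Finset.sum_involution (fun p _ => (p.2, p.1)) ?_ ?_ ?_ ?_
    · intro p _
      rw [hφ.symm p.2 p.1]
      exact ZModModule.add_self _
    · intro p _ hn he
      have := hφ.supp _ _ hn
      have h' : p.2 = p.1 := congrArg Prod.fst he
      rw [h'] at this
      exact this.ne rfl
    · intro p hp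
      simp only [mem_product] at hp ⊢
      exact hp.symm
    · intro p _
      rfl
  rw [sum_product] at h2 ⊢
  have h3 : ∑ u ∈ S, ∑ v, φ u v = ∑ u ∈ S, (∑ v ∈ S, φ u v + ∑ v ∈ Sᶜ, φ u v) :=
    sum_congr rfl fun u _ => (sum_add_sum_compl S _).symm
  rw [sum_add_distrib, h2, zero_add] at h3
  rw [← h3, h1]

end IsFlow

/-- The parity of the number of times that a walk uses the edge `ab`. -/
def walkParity {V : Type*} [DecidableEq V] {G : SimpleGraph V} {u v : V} (p : G.Walk u v)
    (a b : V) : ZMod 2 :=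
  (p.edges.count s(a, b) : ℕ)

section WalkParity

variable {V : Type*} [DecidableEq V] {G : SimpleGraph V}

theorem walkParity_comm {u v : V} (p : G.Walk u v) (a b : V) :
    walkParity p a b = walkParity p b a := by
  simp [walkParity, Sym2.eq_swap]

theorem walkParity_of_notMem {u v : V} (p : G.Walk u v) {a b : V} (h : s(a, b) ∉ p.edges) :
    walkParity p a b = 0 := by
  simp [walkParity, List.count_eq_zero_of_not_mem h]

theorem mem_edges_of_walkParity_ne_zero {u v : V} (p : G.Walk u v) {a b : V}
    (h : walkParity p a b ≠ 0) : s(a, b) ∈ p.edges :=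
  by_contra fun h' => h (walkParity_of_notMem p h')

theorem walkParity_of_isTrail {u v : V} {p : G.Walk u v} (hp : p.IsTrail) {a b : V}
    (h : s(a, b) ∈ p.edges) : walkParity p a b = 1 := by
  simp [walkParity, List.count_eq_one_of_mem hp.edges_nodup h]

theorem walkParity_cons {u v w : V} (h : G.Adj u v) (p : G.Walk v w) (a b : V) :
    walkParity (SimpleGraph.Walk.cons h p) a b =
      walkParity p a b + if s(u, v) = s(a, b) then 1 else 0 := by
  simp only [walkParity, SimpleGraph.Walk.edges_cons, List.count_cons, beq_iff_eq]
  split_ifs <;> simp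

theorem walkParity_append {u v w : V} (p : G.Walk u v) (q : G.Walk v w) (a b : V) :
    walkParity (p.append q) a b = walkParity p a b + walkParity q a b := by
  simp [walkParity, SimpleGraph.Walk.edges_append]

/-- Each passage through an inner vertex uses two edges there, so only the two ends can be odd; they
cancel on a closed walk. -/
theorem sum_walkParity [Fintype V] {u v : V} (p : G.Walk u v) (a : V) :
    ∑ b, walkParity p a b = (if a = u then 1 else 0) + (if a = v then 1 else 0) := by
  induction p with
  | nil => simp [walkParity]; split_ifs <;> decide
  | @cons u w v h p ih =>
    have key : ∑ b, (if s(u, w) = s(a, b) then (1 : ZMod 2) else 0) =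
        (if a = u then 1 else 0) + (if a = w then 1 else 0) := by
      have hne := h.ne
      have : ∀ b, (if s(u, w) = s(a, b) then (1 : ZMod 2) else 0) =
          (if b = w then (if a = u then 1 else 0) else 0) +
          (if b = u then (if a = w then 1 else 0) else 0) := by
        intro b
        simp only [Sym2.eq_iff]
        by_cases h1 : a = u <;> by_cases h2 : a = w <;> by_cases h3 : b = u <;>
          by_cases h4 : b = w <;> subst_vars <;> simp_all [eq_comm]
      rw [sum_congr rfl fun b _ => this b, sum_add_distrib]
      simp
    simp only [walkParity_cons, sum_add_distrib, ih, key]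
    have h2 : ∀ x y z : ZMod 2, x + y + (z + x) = z + y := by decide
    exact h2 _ _ _

theorem isFlow_walkParity [Fintype V] {u : V} (p : G.Walk u u) : IsFlow G (walkParity p) where
  symm := walkParity_comm p
  supp a b h := SimpleGraph.Walk.adj_of_mem_edges p (mem_edges_of_walkParity_ne_zero p h)
  sum_eq_zero a := by
    rw [sum_walkParity]
    split_ifs <;> decide

end WalkParity

namespace SimpleGraph

/-- The edges of `G` with both ends in `B`, as a graph on all vertices. -/
def within {V : Type*} (G : SimpleGraph V) (B : Finset V) : SimpleGraph V where
  Adj u v := G.Adj u v ∧ u ∈ B ∧ v ∈ B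
  symm := ⟨fun _ _ h => ⟨h.1.symm, h.2.2, h.2.1⟩⟩
  loopless := ⟨fun _ h => h.1.ne rfl⟩

theorem within_le {V : Type*} (G : SimpleGraph V) (B : Finset V) : G.within B ≤ G :=
  fun _ _ h => h.1

theorem Reachable.exists_adj_boundary {V : Type*} {G : SimpleGraph V} {u v : V}
    (h : G.Reachable u v) (S : Set V) (hu : u ∈ S) (hv : v ∉ S) :
    ∃ a ∈ S, ∃ b, b ∉ S ∧ G.Adj a b := by
  obtain ⟨p⟩ := h
  obtain ⟨d, -, h1, h2⟩ := p.exists_boundary_dart S hu hv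
  exact ⟨d.fst, h1, d.snd, h2, d.adj⟩

theorem Walk.reachable_of_edges_subset {V : Type*} {G F : SimpleGraph V} {u v w : V}
    (p : G.Walk u v) (h : ∀ e ∈ p.edges, e ∈ F.edgeSet) (hw : w ∈ p.support) :
    F.Reachable u w := by
  classical
  have hw' : w ∈ (p.transfer F h).support := by rwa [Walk.support_transfer]
  exact ⟨(p.transfer F h).takeUntil w hw'⟩

end SimpleGraph

/-! ### Supports of flows and chains of cycles -/

/-- The graph of the pairs on which a function does not vanish. -/
def supportGraph {V Γ : Type*} [Zero Γ] (φ : V → V → Γ) : SimpleGraph V :=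
  SimpleGraph.fromRel fun u v => φ u v ≠ 0

section SupportGraph

variable {V Γ : Type*} [Fintype V] [AddCommGroup Γ] {G : SimpleGraph V} {φ : V → V → Γ}

theorem IsFlow.supportGraph_adj (hφ : IsFlow G φ) {u v : V} :
    (supportGraph φ).Adj u v ↔ φ u v ≠ 0 := by
  rw [supportGraph, SimpleGraph.fromRel_adj, hφ.symm v u, or_self]
  exact ⟨fun h => h.2, fun h => ⟨(hφ.supp _ _ h).ne, h⟩⟩

theorem IsFlow.supportGraph_le (hφ : IsFlow G φ) : supportGraph φ ≤ G :=
  fun _ _ h => hφ.supp _ _ (hφ.supportGraph_adj.1 h)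

/-- The part of a flow on a component of its support is a flow. -/
theorem IsFlow.exists_component (hφ : IsFlow G φ) (x : V) :
    ∃ χ : V → V → Γ, IsFlow G χ ∧
      (∀ u v, χ u v ≠ 0 → (supportGraph χ).Reachable x u) ∧
      (∀ u, (supportGraph φ).Reachable x u → (supportGraph χ).Reachable x u) := by
  classical
  let χ : V → V → Γ := fun u v => if (supportGraph φ).Reachable x u then φ u v else 0
  have hχ : IsFlow G χ := by
    refine ⟨fun u v => ?_, fun u v h => ?_, fun u => ?_⟩
    · by_cases h0 : φ u v = 0
      · have h0' : φ v u = 0 := by rw [hφ.symm, h0]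
        simp [χ, h0, h0']
      · have ha := (hφ.supportGraph_adj.2 h0)
        have : (supportGraph φ).Reachable x u ↔ (supportGraph φ).Reachable x v :=
          ⟨fun h => h.trans ha.reachable, fun h => h.trans ha.symm.reachable⟩
        simp only [χ, this, hφ.symm u v]
    · apply hφ.supp u v
      intro h0
      simp [χ, h0] at h
    · by_cases h : (supportGraph φ).Reachable x u
      · simp [χ, h, hφ.sum_eq_zero]
      · simp [χ, h]
  have key : ∀ u, (supportGraph φ).Reachable x u → (supportGraph χ).Reachable x u := by
    rintro u ⟨p⟩
    refine p.reachable_of_edges_subset (fun e he => ?_) p.end_mem_support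
    induction e with
    | h a b =>
      have hab := p.adj_of_mem_edges he
      have hxa : (supportGraph φ).Reachable x a := ⟨p.takeUntil a (p.fst_mem_support_of_mem_edges he)⟩
      rw [SimpleGraph.mem_edgeSet, hχ.supportGraph_adj]
      simpa [χ, hxa] using hφ.supportGraph_adj.1 hab
  refine ⟨χ, hχ, fun u v h => key u ?_, key⟩
  by_contra hn
  simp [χ, hn] at h

end SupportGraph

/-- The graph in which two vertices are adjacent if they lie on a common closed trail. -/
def closedTrailGraph {V : Type*} (H : SimpleGraph V) : SimpleGraph V :=
  SimpleGraph.fromRel fun u v => ∃ (w : V) (c : H.Walk w w), c.IsTrail ∧ u ∈ c.support ∧ v ∈ c.support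

theorem exists_short_walk_closedTrailGraph {V : Type*} {H : SimpleGraph V} {w u v : V}
    {c : H.Walk w w} (hc : c.IsTrail) (hu : u ∈ c.support) (hv : v ∈ c.support) :
    ∃ q : (closedTrailGraph H).Walk u v, q.length ≤ 1 := by
  by_cases h : u = v
  · subst h
    exact ⟨.nil, by simp⟩
  · have : (closedTrailGraph H).Adj u v :=
      (SimpleGraph.fromRel_adj _ _ _).2 ⟨h, Or.inl ⟨w, c, hc, hu, hv⟩⟩
    exact ⟨this.toWalk, by simp⟩

/-- Two vertices joined by a path all of whose edges lie on cycles are joined in the support of a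
flow with values in `(ℤ/2)²`: take a shortest chain of cycles, and separate the cycles with even
and with odd index. -/
theorem exists_flow_reachable {V : Type*} [Fintype V] {H : SimpleGraph V}
    (hH : ∀ u v, H.Adj u v → ∃ (w : V) (c : H.Walk w w), c.IsCycle ∧ s(u, v) ∈ c.edges)
    {x y : V} (hxy : H.Reachable x y) :
    ∃ ψ : V → V → ZMod 2 × ZMod 2, IsFlow H ψ ∧ (supportGraph ψ).Reachable x y := by
  classical
  have hle : H ≤ closedTrailGraph H := by
    intro u v h
    obtain ⟨w, c, hc, he⟩ := hH u v h
    exact (SimpleGraph.fromRel_adj _ _ _).2 ⟨h.ne, Or.inl ⟨w, c, hc.isTrail,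
      c.fst_mem_support_of_mem_edges he, c.snd_mem_support_of_mem_edges he⟩⟩
  obtain ⟨p, hp⟩ := (hxy.mono hle).exists_walk_length_eq_dist
  have hc : ∀ i, ∃ (w : V) (c : H.Walk w w), c.IsTrail ∧
      (i < p.length → p.getVert i ∈ c.support ∧ p.getVert (i + 1) ∈ c.support) := by
    intro i
    by_cases hi : i < p.length
    · have := p.adj_getVert_succ hi
      obtain ⟨-, ⟨w, c, hc, h1, h2⟩ | ⟨w, c, hc, h1, h2⟩⟩ := (SimpleGraph.fromRel_adj _ _ _).1 this
      · exact ⟨w, c, hc, fun _ => ⟨h1, h2⟩⟩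
      · exact ⟨w, c, hc, fun _ => ⟨h2, h1⟩⟩
    · exact ⟨x, .nil, by simp, fun h => absurd h hi⟩
  choose w c hc hmem using hc
  -- If trails `i` and `j ≥ i + 2` met, two steps through the common vertex would replace at least
  -- three steps of a shortest path.
  have hdisj : ∀ i j, i + 2 ≤ j → j < p.length → ∀ a, a ∈ (c i).support → a ∈ (c j).support →
      False := by
    intro i j hij hj a hai haj
    obtain ⟨q, hq⟩ := exists_short_walk_closedTrailGraph (hc i) (hmem i (by omega)).1 hai
    obtain ⟨r, hr⟩ := exists_short_walk_closedTrailGraph (hc j) haj (hmem j hj).2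
    have := SimpleGraph.dist_le ((p.take i).append (q.append (r.append (p.drop (j + 1)))))
    simp only [SimpleGraph.Walk.length_append, SimpleGraph.Walk.take_length,
      SimpleGraph.Walk.drop_length] at this
    omega
  -- Trails whose indices have equal parity are disjoint, so giving each parity its own coordinate
  -- prevents cancellation.
  let κ : ℕ → ZMod 2 × ZMod 2 := fun i => if Even i then (1, 0) else (0, 1)
  let ψ : V → V → ZMod 2 × ZMod 2 :=
    fun u v => ∑ i ∈ range p.length, walkParity (c i) u v • κ i
  have hψ : IsFlow H ψ := IsFlow.sum _ fun i _ => (isFlow_walkParity (c i)).smul_const (κ i)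
  have hne : ∀ i < p.length, ∀ a b, s(a, b) ∈ (c i).edges → ψ a b ≠ 0 := by
    intro i hi a b hab h0
    have hz : ∀ j ∈ range p.length, j ≠ i → (Even j ↔ Even i) → walkParity (c j) a b = 0 := by
      intro j hj hji hpar
      rw [mem_range] at hj
      refine walkParity_of_notMem _ fun hab' => ?_
      have h1 := (c i).fst_mem_support_of_mem_edges hab
      have h2 := (c j).fst_mem_support_of_mem_edges hab'
      rcases lt_or_gt_of_ne hji with h | h
      · exact hdisj j i (by grind) hi a h2 h1
      · exact hdisj i j (by grind) hj a h1 h2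
    have h1 := walkParity_of_isTrail (hc i) hab
    by_cases he : Even i
    · have : (ψ a b).1 = 1 := by
        simp only [ψ, Prod.fst_sum, Prod.smul_fst]
        rw [sum_eq_single_of_mem i (mem_range.2 hi)]
        · simp [κ, he, h1]
        · intro j hj hji
          by_cases hej : Even j
          · rw [hz j hj hji (by tauto), zero_smul]
          · simp [κ, hej]
      rw [h0] at this
      exact absurd this (by decide)
    · have : (ψ a b).2 = 1 := by
        simp only [ψ, Prod.snd_sum, Prod.smul_snd]
        rw [sum_eq_single_of_mem i (mem_range.2 hi)]
        · simp [κ, he, h1]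
        · intro j hj hji
          by_cases hej : Even j
          · simp [κ, hej]
          · rw [hz j hj hji (by tauto), zero_smul]
      rw [h0] at this
      exact absurd this (by decide)
  have hedge : ∀ i < p.length, ∀ e ∈ (c i).edges, e ∈ (supportGraph ψ).edgeSet := by
    intro i hi e he
    induction e with
    | h a b => exact hψ.supportGraph_adj.2 (hne i hi a b he)
  have hreach : ∀ i ≤ p.length, (supportGraph ψ).Reachable x (p.getVert i) := by
    intro i
    induction i with
    | zero => intro _; simp
    | succ i ih =>
      intro hi
      have hm := hmem i (by omega)
      exact (ih (by omega)).trans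
        (((c i).reachable_of_edges_subset (hedge i (by omega)) hm.1).symm.trans
          ((c i).reachable_of_edges_subset (hedge i (by omega)) hm.2))
  refine ⟨ψ, hψ, ?_⟩
  simpa using hreach p.length le_rfl

/-! ### Minimal sets with at most one exit -/

/-- At most one edge of `G` leaves `B` for a vertex outside `A ∪ B`. -/
def AtMostOneExit {V : Type*} (G : SimpleGraph V) (A B : Finset V) : Prop :=
  ∀ u v u' v', u ∈ B → v ∉ A → v ∉ B → G.Adj u v → u' ∈ B → v' ∉ A → v' ∉ B → G.Adj u' v' →
    u = u' ∧ v = v'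

/-- `B` is minimal among the nonempty sets disjoint from `A` with at most one exit. -/
structure IsMinimalExit {V : Type*} (G : SimpleGraph V) (A B : Finset V) : Prop where
  nonempty : B.Nonempty
  disjoint : ∀ v ∈ B, v ∉ A
  exit : AtMostOneExit G A B
  minimal : ∀ C ⊆ B, C.Nonempty → AtMostOneExit G A C → C = B

section MinimalExit

variable {V : Type*} [Fintype V] {G : SimpleGraph V} {A B : Finset V}

theorem exists_isMinimalExit (hA : ∃ v, v ∉ A) : ∃ B, IsMinimalExit G A B := by
  classical
  obtain ⟨B, hB, hmin⟩ := exists_min_image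
    (univ.filter fun B : Finset V => B.Nonempty ∧ (∀ v ∈ B, v ∉ A) ∧ AtMostOneExit G A B) card
    ⟨Aᶜ, by
      obtain ⟨v, hv⟩ := hA
      refine mem_filter.2 ⟨mem_univ _, ⟨v, by simpa using hv⟩, fun v hv => by simpa using hv, ?_⟩
      intro u v u' v' _ hv hv'
      exact absurd (mem_compl.2 hv) hv'⟩
  obtain ⟨-, h1, h2, h3⟩ := mem_filter.1 hB
  refine ⟨B, h1, h2, h3, fun C hC hne hex => ?_⟩
  exact eq_of_subset_of_card_le hC
    (hmin C (mem_filter.2 ⟨mem_univ _, hne, fun v hv => h2 v (hC hv), hex⟩))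

/-- A minimal set with one exit is `2`-edge-connected. -/
theorem IsMinimalExit.exists_two_edges (hB : IsMinimalExit G A B) {S : Finset V} (hS : S ⊆ B)
    (hne : S.Nonempty) (hne' : S ≠ B) :
    ∃ u v u' v', u ∈ S ∧ v ∈ B ∧ v ∉ S ∧ G.Adj u v ∧ u' ∈ S ∧ v' ∈ B ∧ v' ∉ S ∧ G.Adj u' v' ∧
      ¬(u = u' ∧ v = v') := by
  classical
  have two : ∀ C ⊆ B, C.Nonempty → C ≠ B → ∃ u v u' v', u ∈ C ∧ v ∉ A ∧ v ∉ C ∧ G.Adj u v ∧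
      u' ∈ C ∧ v' ∉ A ∧ v' ∉ C ∧ G.Adj u' v' ∧ ¬(u = u' ∧ v = v') := by
    intro C hC hn hCB
    by_contra hcon
    apply hCB
    refine hB.minimal C hC hn ?_
    intro u v u' v' h1 h2 h3 h4 h5 h6 h7 h8
    by_contra h9
    exact hcon ⟨u, v, u', v', h1, h2, h3, h4, h5, h6, h7, h8, h9⟩
  have hT : (B \ S).Nonempty := by
    rw [nonempty_iff_ne_empty, Ne, sdiff_eq_empty_iff_subset]
    exact fun h => hne' (hS.antisymm h)
  have hT' : B \ S ≠ B := by
    obtain ⟨s, hs⟩ := hne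
    intro h
    have := hS hs
    rw [← h] at this
    exact (mem_sdiff.1 this).2 hs
  -- If the only exit of `B` starts in `S`, then `B \ S` has none, so the two edges that minimality
  -- gives to `B \ S` both end in `S`.
  have aux : ∀ u v, u ∈ S → v ∉ A → v ∉ B → G.Adj u v → ∃ u v u' v', u ∈ S ∧ v ∈ B ∧ v ∉ S ∧
      G.Adj u v ∧ u' ∈ S ∧ v' ∈ B ∧ v' ∉ S ∧ G.Adj u' v' ∧ ¬(u = u' ∧ v = v') := by
    intro u v hu hvA hvB huv
    obtain ⟨w, z, w', z', hw, hzA, hz, hwz, hw', hzA', hz', hwz', hd⟩ := two _ sdiff_subset hT hT'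
    have side : ∀ w z, w ∈ B \ S → z ∉ A → z ∉ B \ S → G.Adj w z → z ∈ S := by
      intro w z hw hzA hz hwz
      by_contra hzS
      have hzB : z ∉ B := fun h => hz (mem_sdiff.2 ⟨h, hzS⟩)
      have := hB.exit u v w z (hS hu) hvA hvB huv (mem_sdiff.1 hw).1 hzA hzB hwz
      exact (mem_sdiff.1 hw).2 (this.1 ▸ hu)
    refine ⟨z, w, z', w', side _ _ hw hzA hz hwz, (mem_sdiff.1 hw).1, (mem_sdiff.1 hw).2, hwz.symm,
      side _ _ hw' hzA' hz' hwz', (mem_sdiff.1 hw').1, (mem_sdiff.1 hw').2, hwz'.symm, ?_⟩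
    exact fun h => hd ⟨h.2, h.1⟩
  obtain ⟨u, v, u', v', hu, hvA, hv, huv, hu', hvA', hv', huv', hd⟩ := two S hS hne hne'
  by_cases hvB : v ∈ B
  · by_cases hvB' : v' ∈ B
    · exact ⟨u, v, u', v', hu, hvB, hv, huv, hu', hvB', hv', huv', hd⟩
    · exact aux u' v' hu' hvA' hvB' huv'
  · exact aux u v hu hvA hvB huv

/-- Otherwise `uv` would be the only edge between two parts of `B`, where minimality provides two.
-/
theorem IsMinimalExit.exists_isCycle (hB : IsMinimalExit G A B) {u v : V}
    (h : (G.within B).Adj u v) :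
    ∃ (w : V) (c : (G.within B).Walk w w), c.IsCycle ∧ s(u, v) ∈ c.edges := by
  classical
  refine SimpleGraph.adj_and_reachable_delete_edges_iff_exists_cycle.1 ⟨h, ?_⟩
  by_contra hn
  let D := (G.within B).deleteEdges {s(u, v)}
  let S : Finset V := B.filter fun w => D.Reachable u w
  have huS : u ∈ S := mem_filter.2 ⟨h.2.1, SimpleGraph.Reachable.refl _⟩
  have hvS : v ∉ S := fun hv => hn (mem_filter.1 hv).2
  obtain ⟨a, b, a', b', ha, hbB, hb, hab, ha', hbB', hb', hab', hd⟩ :=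
    hB.exists_two_edges (filter_subset _ _ : S ⊆ B) ⟨u, huS⟩ (fun hS => hvS (by rw [show S = B from hS]; exact h.2.2))
  have key : ∀ a b, a ∈ S → b ∈ B → b ∉ S → G.Adj a b → a = u ∧ b = v := by
    intro a b ha hbB hb hab
    by_cases he : s(a, b) = s(u, v)
    · rcases Sym2.eq_iff.1 he with h' | ⟨h', -⟩
      · exact h'
      · exact absurd (h' ▸ ha) hvS
    · refine absurd (mem_filter.2 ⟨hbB, (mem_filter.1 ha).2.trans ?_⟩) hb
      refine SimpleGraph.Adj.reachable ?_
      rw [SimpleGraph.deleteEdges_adj]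
      exact ⟨⟨hab, (mem_filter.1 ha).1, hbB⟩, he⟩
  have h1 := key a b ha hbB hb hab
  have h2 := key a' b' ha' hbB' hb' hab'
  exact hd ⟨h1.1.trans h2.1.symm, h1.2.trans h2.2.symm⟩

theorem IsMinimalExit.reachable (hB : IsMinimalExit G A B) {x y : V} (hx : x ∈ B) (hy : y ∈ B) :
    (G.within B).Reachable x y := by
  classical
  by_contra hn
  let S : Finset V := B.filter fun w => (G.within B).Reachable x w
  have hxS : x ∈ S := mem_filter.2 ⟨hx, SimpleGraph.Reachable.refl _⟩
  have hyS : y ∉ S := fun hv => hn (mem_filter.1 hv).2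
  obtain ⟨a, b, -, -, ha, hbB, hb, hab, -⟩ :=
    hB.exists_two_edges (filter_subset _ _ : S ⊆ B) ⟨x, hxS⟩ (fun hS => hyS (by rw [show S = B from hS]; exact hy))
  refine hb (mem_filter.2 ⟨hbB, (mem_filter.1 ha).2.trans ?_⟩)
  exact SimpleGraph.Adj.reachable ⟨hab, (mem_filter.1 ha).1, hbB⟩

end MinimalExit

/-! ### Construction of the pair of flows -/

/-- In a cut of a graph, an edge that is not a bridge is not alone. -/
theorem exists_other_cut_edge {V : Type*} {G : SimpleGraph V} {u v : V}
    (h : ¬ G.IsBridge s(u, v)) (S : Set V) (hu : u ∈ S) (hv : v ∉ S) :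
    ∃ a ∈ S, ∃ b, b ∉ S ∧ G.Adj a b ∧ s(a, b) ≠ s(u, v) := by
  rw [SimpleGraph.isBridge_iff, not_not] at h
  obtain ⟨a, ha, b, hb, hab⟩ := h.exists_adj_boundary S hu hv
  rw [SimpleGraph.deleteEdges_adj] at hab
  exact ⟨a, ha, b, hb, hab.1, hab.2⟩

theorem walkParity_mapLe_of_not_adj {V : Type*} [DecidableEq V] {Q G : SimpleGraph V} (h : Q ≤ G)
    {u v a b : V} (p : Q.Walk u v) (hab : ¬ Q.Adj a b) : walkParity (p.mapLe h) a b = 0 := by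
  refine walkParity_of_notMem _ fun hm => hab ?_
  rw [SimpleGraph.Walk.edges_mapLe_eq_edges] at hm
  exact p.adj_of_mem_edges hm

/-- A flow can be made nonzero on edges with ends connected in `Q`, changing it only on these
edges and on `Q`. -/
theorem IsFlow.exists_ne_zero_of_reachable {V : Type*} [Fintype V] {G Q : SimpleGraph V}
    {θ : V → V → ZMod 2 × ZMod 2} (hθ : IsFlow G θ) (hQ : Q ≤ G) (F : Finset (Sym2 V))
    (hF : ∀ u v, s(u, v) ∈ F → G.Adj u v ∧ ¬ Q.Adj u v ∧ Q.Reachable u v) :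
    ∃ θ' : V → V → ZMod 2 × ZMod 2, IsFlow G θ' ∧
      (∀ u v, ¬ Q.Adj u v → s(u, v) ∉ F → θ' u v = θ u v) ∧
      ∀ u v, s(u, v) ∈ F → θ' u v ≠ 0 := by
  classical
  induction F using Finset.induction_on with
  | empty => exact ⟨θ, hθ, fun _ _ _ _ => rfl, fun _ _ h => absurd h (notMem_empty _)⟩
  | insert e F he ih =>
    obtain ⟨θ₁, h₁, hagree, hne⟩ := ih fun u v h => hF u v (mem_insert_of_mem h)
    induction e with
    | h a b =>
      obtain ⟨hab, hQab, ⟨p⟩⟩ := hF a b (mem_insert_self _ _)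
      by_cases h0 : θ₁ a b = 0
      -- Off `Q` this closed walk uses only `ab`, so adding it leaves the other edges of `F`
      -- unchanged.
      · let c : G.Walk a a := .cons hab (p.mapLe hQ).reverse
        have hc : ∀ u v, ¬ Q.Adj u v → walkParity c u v = if s(a, b) = s(u, v) then 1 else 0 := by
          intro u v huv
          have : walkParity (p.mapLe hQ).reverse u v = walkParity (p.mapLe hQ) u v := by
            simp [walkParity]
          rw [walkParity_cons, this, walkParity_mapLe_of_not_adj hQ p huv, zero_add]
        refine ⟨_, h₁.add ((isFlow_walkParity c).smul_const (1, 0)), ?_, ?_⟩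
        · intro u v huv hm
          rw [mem_insert, not_or] at hm
          simp only [hc u v huv, if_neg (Ne.symm hm.1), zero_smul, add_zero]
          exact hagree u v huv hm.2
        · intro u v hm
          have huv := (hF u v hm).2.1
          simp only [hc u v huv]
          by_cases hs : s(a, b) = s(u, v)
          · have h0' : θ₁ u v = 0 := by
              rcases Sym2.eq_iff.1 hs with ⟨rfl, rfl⟩ | ⟨rfl, rfl⟩
              · exact h0
              · rw [h₁.symm, h0]
            rw [if_pos hs, h0']
            decide
          · rw [if_neg hs, zero_smul, add_zero]
            exact hne u v ((mem_insert.1 hm).resolve_left (Ne.symm hs))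
      · refine ⟨θ₁, h₁, fun u v huv hm => hagree u v huv fun h => hm (mem_insert_of_mem h), ?_⟩
        intro u v hm
        rcases mem_insert.1 hm with hs | hm
        · rcases Sym2.eq_iff.1 hs with ⟨rfl, rfl⟩ | ⟨rfl, rfl⟩
          · exact h0
          · rwa [h₁.symm]
        · exact hne u v hm

/-- Two edges that form a cut carry the same value of a flow. -/
theorem IsFlow.eq_of_two_edge_cut {V Γ : Type*} [Fintype V] [AddCommGroup Γ] [Module (ZMod 2) Γ]
    {G : SimpleGraph V} {φ : V → V → Γ} (hφ : IsFlow G φ) (B : Finset V) {x a p q : V}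
    (hx : x ∈ B) (ha : a ∉ B) (hp : p ∈ B) (hq : q ∉ B) (hne : ¬(p = x ∧ q = a))
    (honly : ∀ u v, u ∈ B → v ∉ B → G.Adj u v → (u = x ∧ v = a) ∨ (u = p ∧ v = q)) :
    φ x a = φ p q := by
  classical
  have h := hφ.sum_cut_eq_zero B
  have hsub : ({(x, a), (p, q)} : Finset (V × V)) ⊆ B ×ˢ Bᶜ := by
    intro z hz
    rw [mem_insert, mem_singleton] at hz
    rcases hz with rfl | rfl <;> simp [*]
  rw [← sum_subset hsub, sum_pair] at h
  · have h2 := ZModModule.add_self (φ p q)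
    exact add_right_cancel (h.trans h2.symm)
  · exact fun he => hne ⟨(congrArg Prod.fst he).symm, (congrArg Prod.snd he).symm⟩
  · rintro ⟨u, v⟩ hz hz'
    rw [mem_product, mem_compl] at hz
    by_contra hn
    rcases honly u v hz.1 hz.2 (hφ.supp _ _ hn) with ⟨rfl, rfl⟩ | ⟨rfl, rfl⟩ <;> simp at hz'

section Absorb

variable {V : Type*} [DecidableEq V] {G F : SimpleGraph V} {A W : Finset V} {x a : V}

/-- If connections inside `A` agree with connections in `G`, and `W` is attached to `A` by an edge
`xa`, then connections inside `A ∪ W` agree with connections in `G`. -/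
theorem reachable_absorb (hA : ∀ u ∈ A, ∀ v ∈ A, G.Reachable u v → (G.within A).Reachable u v)
    (hF : F ≤ G) (hW : ∀ w ∈ W, F.Reachable x w) (hxa : G.Adj x a) (ha : a ∈ A) {u v : V}
    (hu : u ∈ A ∪ W) (hv : v ∈ A ∪ W) (huv : G.Reachable u v) :
    (G.within A ⊔ F ⊔ SimpleGraph.edge x a).Reachable u v := by
  have hQA : G.within A ≤ G.within A ⊔ F ⊔ SimpleGraph.edge x a := le_sup_left.trans le_sup_left
  have hQF : F ≤ G.within A ⊔ F ⊔ SimpleGraph.edge x a := le_sup_right.trans le_sup_left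
  have hQ : G.within A ⊔ F ⊔ SimpleGraph.edge x a ≤ G :=
    sup_le (sup_le (G.within_le A) hF) ((SimpleGraph.edge_le_iff _).2 (Or.inr hxa))
  have hxa' : (G.within A ⊔ F ⊔ SimpleGraph.edge x a).Reachable x a := by
    refine SimpleGraph.Adj.reachable (Or.inr ?_)
    rw [SimpleGraph.edge_adj]
    exact ⟨Or.inl ⟨rfl, rfl⟩, hxa.ne⟩
  have key : ∀ w ∈ A ∪ W, ∃ b ∈ A, (G.within A ⊔ F ⊔ SimpleGraph.edge x a).Reachable w b := by
    intro w hw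
    rcases mem_union.1 hw with h | h
    · exact ⟨w, h, SimpleGraph.Reachable.refl _⟩
    · exact ⟨a, ha, ((hW w h).mono hQF).symm.trans hxa'⟩
  obtain ⟨b, hb, hub⟩ := key u hu
  obtain ⟨c, hc, hvc⟩ := key v hv
  have hbc := (hA b hb c hc (((hub.mono hQ).symm.trans huv).trans (hvc.mono hQ))).mono hQA
  exact (hub.trans hbc).trans hvc.symm

end Absorb

/-- Relative version of the existence of nowhere-zero flows: there are flows `ψ`, supported off
`A`, and `θ` that do not vanish simultaneously on edges that are not inside `A`. -/
theorem exists_flow_pair {V : Type*} [Fintype V] {G : SimpleGraph V}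
    (hG : ∀ u v, G.Adj u v → ¬ G.IsBridge s(u, v)) (A : Finset V)
    (hA : ∀ u ∈ A, ∀ v ∈ A, G.Reachable u v → (G.within A).Reachable u v) :
    ∃ ψ θ : V → V → ZMod 2 × ZMod 2, IsFlow G ψ ∧ IsFlow G θ ∧
      (∀ u v, ψ u v ≠ 0 → u ∉ A ∧ v ∉ A) ∧
      ∀ u v, G.Adj u v → ¬(u ∈ A ∧ v ∈ A) → ψ u v ≠ 0 ∨ θ u v ≠ 0 := by
  classical
  induction hn : Aᶜ.card using Nat.strong_induction_on generalizing A with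
  | _ n ih =>
  subst hn
  by_cases hfull : ∀ v, v ∈ A
  · exact ⟨_, _, IsFlow.zero G, IsFlow.zero G, fun _ _ h => absurd rfl h,
      fun u v _ h => absurd ⟨hfull u, hfull v⟩ h⟩
  push Not at hfull
  obtain ⟨B, hB⟩ := exists_isMinimalExit (G := G) hfull
  have hBA := hB.disjoint
  have hcard : ∀ W : Finset V, ∀ w ∈ W, w ∉ A → (A ∪ W)ᶜ.card < Aᶜ.card := by
    intro W w hw hwA
    refine card_lt_card (compl_ssubset_compl.2 ?_)
    exact Finset.ssubset_iff_subset_ne.2 ⟨subset_union_left, fun h => hwA (h ▸ mem_union_right A hw)⟩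
  by_cases h0 : ∃ x ∈ B, ∃ a ∈ A, G.Adj x a
  swap
  · -- no edge joins `B` to `A`
    push Not at h0
    obtain ⟨x, hx⟩ := hB.nonempty
    -- An edge leaving `B` would be the only exit, hence alone in its cut, hence a bridge. So no
    -- edge leaves `B`, and `x` may join `A` as a separate component.
    have hcut : ∀ u v, u ∈ B → v ∉ B → ¬ G.Adj u v := by
      intro u v hu hv huv
      obtain ⟨a, ha, b, hb, hab, hne⟩ := exists_other_cut_edge (hG u v huv) (B : Set V) hu hv
      have h := hB.exit u v a b hu (fun h => h0 u hu v h huv) hv huv ha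
        (fun h => h0 a ha b h hab) hb hab
      exact hne (by rw [h.1, h.2])
    have hxr : ∀ u ∈ A, ¬ G.Reachable x u := by
      intro u hu h
      obtain ⟨a, ha, b, hb, hab⟩ := h.exists_adj_boundary (B : Set V) hx (fun h => hBA u h hu)
      exact hcut a b ha hb hab
    have hle : G.within A ≤ G.within (A ∪ {x}) :=
      fun u v h => ⟨h.1, mem_union_left _ h.2.1, mem_union_left _ h.2.2⟩
    obtain ⟨ψ, θ, h1, h2, h3, h4⟩ := ih _ (hcard {x} x (mem_singleton_self x) (hBA x hx))
      (A ∪ {x}) (by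
        intro u hu v hv huv
        rw [mem_union, mem_singleton] at hu hv
        rcases hu with hu | rfl <;> rcases hv with hv | rfl
        · exact (hA u hu v hv huv).mono hle
        · exact absurd huv.symm (hxr u hu)
        · exact absurd huv (hxr v hv)
        · exact SimpleGraph.Reachable.refl _) rfl
    refine ⟨ψ, θ, h1, h2, fun u v h => ?_, fun u v huv h => h4 u v huv fun h' => h ?_⟩
    · exact ⟨fun hu => (h3 u v h).1 (mem_union_left _ hu),
        fun hv => (h3 u v h).2 (mem_union_left _ hv)⟩
    · obtain ⟨hu, hv⟩ := h'
      rw [mem_union, mem_singleton] at hu hv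
      rcases hu with hu | rfl <;> rcases hv with hv | rfl
      · exact ⟨hu, hv⟩
      · exact absurd huv.symm (h0 v hx u hu)
      · exact absurd huv (h0 u hx v hv)
      · exact absurd rfl huv.ne
  obtain ⟨x, hx, a, ha, hxa⟩ := h0
  have hxA := hBA x hx
  have haB : a ∉ B := fun h => hBA a h ha
  by_cases h2 : ∃ y ∈ B, ∃ a' ∈ A, G.Adj y a' ∧ ¬(y = x ∧ a' = a)
  swap
  · -- exactly one edge joins `B` to `A`
    have huniq : ∀ y ∈ B, ∀ a' ∈ A, G.Adj y a' → y = x ∧ a' = a := by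
      intro y hy a' ha' h
      by_contra hc
      exact h2 ⟨y, hy, a', ha', h, hc⟩
    -- As `xa` is not a bridge, a second edge leaves `B`. It avoids `A`, so it is the exit, and `xa`
    -- and `pq` form a cut.
    obtain ⟨p, hp, q, hq, hpq, hne⟩ := exists_other_cut_edge (hG x a hxa) (B : Set V) hx haB
    have hqA : q ∉ A := fun h => hne (by
      obtain ⟨rfl, rfl⟩ := huniq p hp q h hpq
      rfl)
    have hFle : (⊥ : SimpleGraph V) ≤ G := bot_le
    obtain ⟨ψ, θ, hψG, hθG, h3, h4⟩ := ih _ (hcard {x} x (mem_singleton_self x) hxA)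
      (A ∪ {x}) (by
        intro u hu v hv huv
        refine (reachable_absorb hA hFle (W := {x}) (x := x) ?_ hxa ha hu hv huv).mono ?_
        · intro w hw
          rw [mem_singleton.1 hw]
        · refine sup_le (sup_le ?_ bot_le) ((SimpleGraph.edge_le_iff _).2 (Or.inr ?_))
          · exact fun u v h => ⟨h.1, mem_union_left _ h.2.1, mem_union_left _ h.2.2⟩
          · exact ⟨hxa, by simp [ha]⟩) rfl
    have honly : ∀ u v, u ∈ B → v ∉ B → G.Adj u v → (u = x ∧ v = a) ∨ (u = p ∧ v = q) := by
      intro u v hu hv huv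
      by_cases hvA : v ∈ A
      · exact Or.inl (huniq u hu v hvA huv)
      · exact Or.inr (hB.exit u v p q hu hvA hv huv hp hqA hq hpq)
    have hne' : ¬(p = x ∧ q = a) := fun h => hne (by rw [h.1, h.2])
    have hψ := hψG.eq_of_two_edge_cut B hx haB hp hq hne' honly
    have hθ := hθG.eq_of_two_edge_cut B hx haB hp hq hne' honly
    have hqx : ¬(p ∈ A ∪ {x} ∧ q ∈ A ∪ {x}) := by
      intro h
      rcases mem_union.1 h.2 with h' | h'
      · exact hqA h'
      · exact hq (mem_singleton.1 h' ▸ hx)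
    have hval := h4 p q hpq hqx
    -- The edge `xa` lies inside `A ∪ {x}`, where induction says nothing; it inherits the values at
    -- `pq`.
    rw [← hψ, ← hθ] at hval
    refine ⟨ψ, θ, hψG, hθG, fun u v h => ?_, fun u v huv h => ?_⟩
    · exact ⟨fun hu => (h3 u v h).1 (mem_union_left _ hu),
        fun hv => (h3 u v h).2 (mem_union_left _ hv)⟩
    · by_cases h' : u ∈ A ∪ {x} ∧ v ∈ A ∪ {x}
      · obtain ⟨hu, hv⟩ := h'
        rw [mem_union, mem_singleton] at hu hv
        rcases hu with hu | rfl <;> rcases hv with hv | rfl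
        · exact absurd ⟨hu, hv⟩ h
        · obtain ⟨-, rfl⟩ := huniq v hx u hu huv.symm
          rwa [hψG.symm u, hθG.symm u]
        · obtain ⟨-, rfl⟩ := huniq u hx v hv huv
          exact hval
        · exact absurd rfl huv.ne
      · exact h4 u v huv h'
  · -- at least two edges join `B` to `A`
    obtain ⟨y, hy, a', ha', hya', hne⟩ := h2
    obtain ⟨ψ₀, hψ₀, hxy₀⟩ := exists_flow_reachable (fun u v h => hB.exists_isCycle h)
      (hB.reachable hx hy)
    obtain ⟨ω, hω, hωx, hωr⟩ := hψ₀.exists_component x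
    have hxy := hωr y hxy₀
    have hFB := hω.supportGraph_le
    have hωG := hω.mono (G.within_le B)
    set F := supportGraph ω with hFdef
    have hFG : F ≤ G := hωG.supportGraph_le
    have hFadj : ∀ {u v}, F.Adj u v ↔ ω u v ≠ 0 := hωG.supportGraph_adj
    let W : Finset V := univ.filter fun w => F.Reachable x w
    have hW : ∀ w, w ∈ W ↔ F.Reachable x w := fun w => by simp [W]
    have hxW : x ∈ W := (hW x).2 (SimpleGraph.Reachable.refl _)
    have hyW : y ∈ W := (hW y).2 hxy
    have hWB : ∀ w ∈ W, w ∈ B := by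
      intro w hw
      by_contra hwB
      obtain ⟨c, -, d, hd, hcd⟩ := ((hW w).1 hw).exists_adj_boundary (B : Set V) hx hwB
      exact hd (hFB hcd).2.2
    have hWA : ∀ w ∈ W, w ∉ A := fun w hw => hBA w (hWB w hw)
    have hFW : ∀ u v, F.Adj u v → u ∈ W ∧ v ∈ W := by
      intro u v h
      have hu := hωx u v (hFadj.1 h)
      exact ⟨(hW u).2 hu, (hW v).2 (hu.trans h.reachable)⟩
    set Q := G.within A ⊔ F ⊔ SimpleGraph.edge x a with hQdef
    have hQadj : ∀ u v, Q.Adj u v ↔ (G.Adj u v ∧ u ∈ A ∧ v ∈ A) ∨ F.Adj u v ∨ s(u, v) = s(x, a) := by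
      intro u v
      simp only [hQdef, SimpleGraph.sup_adj, SimpleGraph.edge_adj, or_assoc]
      refine or_congr Iff.rfl (or_congr Iff.rfl ?_)
      rw [Sym2.eq_iff]
      constructor
      · rintro ⟨h | h, -⟩
        · exact Or.inl ⟨h.1, h.2⟩
        · exact Or.inr ⟨h.1, h.2⟩
      · rintro (⟨rfl, rfl⟩ | ⟨rfl, rfl⟩)
        · exact ⟨Or.inl ⟨rfl, rfl⟩, hxa.ne⟩
        · exact ⟨Or.inr ⟨rfl, rfl⟩, hxa.ne'⟩
    have hQW : Q ≤ G.within (A ∪ W) := by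
      intro u v h
      rcases (hQadj u v).1 h with h | h | h
      · exact ⟨h.1, mem_union_left _ h.2.1, mem_union_left _ h.2.2⟩
      · exact ⟨hFG h, mem_union_right _ (hFW _ _ h).1, mem_union_right _ (hFW _ _ h).2⟩
      · rcases Sym2.eq_iff.1 h with ⟨rfl, rfl⟩ | ⟨rfl, rfl⟩
        · exact ⟨hxa, mem_union_right _ hxW, mem_union_left _ ha⟩
        · exact ⟨hxa.symm, mem_union_left _ ha, mem_union_right _ hxW⟩
    have hQr : ∀ u ∈ A ∪ W, ∀ v ∈ A ∪ W, G.Reachable u v → Q.Reachable u v :=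
      fun u hu v hv huv => reachable_absorb hA hFG (fun w hw => (hW w).1 hw) hxa ha hu hv huv
    have hQG : Q ≤ G := hQW.trans (G.within_le _)
    obtain ⟨ψ, θ, h1, h2, h3, h4⟩ := ih _ (hcard W x hxW hxA) (A ∪ W)
      (fun u hu v hv huv => (hQr u hu v hv huv).mono hQW) rfl
    -- The edges inside `A ∪ W` that must be repaired through `Q`. Those in `F` are left to `ω`,
    -- while `xa` is needed in `Q` and is treated separately.
    let S : Finset (Sym2 V) :=
      univ.filter fun e => e ∈ G.edgeSet ∧ e ∉ Q.edgeSet ∧ ∀ v ∈ e, v ∈ A ∪ W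
    have hS : ∀ u v, s(u, v) ∈ S ↔ G.Adj u v ∧ ¬ Q.Adj u v ∧ u ∈ A ∪ W ∧ v ∈ A ∪ W := by
      intro u v
      simp [S]
    obtain ⟨θ₁, hθ₁, hθ₁eq, hθ₁ne⟩ := h2.exists_ne_zero_of_reachable hQG S (by
      intro u v h
      obtain ⟨h5, h6, h7, h8⟩ := (hS u v).1 h
      exact ⟨h5, h6, hQr u h7 v h8 h5.reachable⟩)
    -- a closed walk through `xa` and `ya'` that is otherwise inside `A` and `F`
    have haa' : G.Reachable a a' :=
      (hxa.symm.reachable.trans (hxy.mono hFG)).trans hya'.reachable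
    obtain ⟨p⟩ := hA a ha a' ha' haa'
    obtain ⟨q⟩ := hxy.symm
    let c : G.Walk x x := .cons hxa ((p.mapLe (G.within_le A)).append (.cons hya'.symm (q.mapLe hFG)))
    have hc : ∀ u v, ¬(u ∈ A ∧ v ∈ A) → ¬ F.Adj u v →
        walkParity c u v = (if s(y, a') = s(u, v) then 1 else 0) +
          if s(x, a) = s(u, v) then 1 else 0 := by
      intro u v huv hF
      have hAuv : ¬ (G.within A).Adj u v := fun h => huv h.2
      simp only [c, walkParity_cons, walkParity_append, walkParity_mapLe_of_not_adj _ p hAuv,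
        walkParity_mapLe_of_not_adj _ q hF, zero_add, Sym2.eq_swap (a := a')]
    have hne2 : s(y, a') ≠ s(x, a) := by
      rw [Ne, Sym2.eq_iff]
      rintro (h | h)
      · exact hne h
      · exact hxA (h.2 ▸ ha')
    have hcW : ∀ u v, ¬(u ∈ A ∪ W ∧ v ∈ A ∪ W) → walkParity c u v = 0 := by
      intro u v h
      rw [hc u v (fun h' => h ⟨mem_union_left _ h'.1, mem_union_left _ h'.2⟩)
        (fun h' => h ⟨mem_union_right _ (hFW _ _ h').1, mem_union_right _ (hFW _ _ h').2⟩),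
        if_neg, if_neg, add_zero]
      · intro he
        rcases Sym2.eq_iff.1 he with ⟨rfl, rfl⟩ | ⟨rfl, rfl⟩
        · exact h ⟨mem_union_right _ hxW, mem_union_left _ ha⟩
        · exact h ⟨mem_union_left _ ha, mem_union_right _ hxW⟩
      · intro he
        rcases Sym2.eq_iff.1 he with ⟨rfl, rfl⟩ | ⟨rfl, rfl⟩
        · exact h ⟨mem_union_right _ hyW, mem_union_left _ ha'⟩
        · exact h ⟨mem_union_left _ ha', mem_union_right _ hyW⟩
    -- The two conditions forbid at most two of the four elements of `(ℤ/2)²`. Adding `γ` along `c`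
    -- affects, outside `A` and `F`, only `xa` and `ya'`.
    obtain ⟨γ, hγ1, hγ2⟩ : ∃ γ : ZMod 2 × ZMod 2, θ₁ x a + γ ≠ 0 ∧ θ₁ y a' + γ ≠ 0 := by
      have : ∀ s t : ZMod 2 × ZMod 2, ∃ γ : ZMod 2 × ZMod 2, s + γ ≠ 0 ∧ t + γ ≠ 0 := by decide
      exact this _ _
    refine ⟨_, _, h1.add hωG, hθ₁.add ((isFlow_walkParity c).smul_const γ), ?_, ?_⟩
    · intro u v h
      by_cases hψ : ψ u v = 0
      · rw [hψ, zero_add] at h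
        have := hFW u v (hFadj.2 h)
        exact ⟨hWA u this.1, hWA v this.2⟩
      · have := h3 u v hψ
        exact ⟨fun hu => this.1 (mem_union_left _ hu), fun hv => this.2 (mem_union_left _ hv)⟩
    · intro u v huv hAuv
      by_cases hin : u ∈ A ∪ W ∧ v ∈ A ∪ W
      · have hψ : ψ u v = 0 := by_contra fun h => (h3 u v h).1 hin.1
        by_cases hFuv : F.Adj u v
        · left
          rw [hψ, zero_add]
          exact hFadj.1 hFuv
        · right
          simp only [hc u v hAuv hFuv]
          by_cases he : s(x, a) = s(u, v)
          · rw [if_pos he, if_neg (fun h => hne2 (h.trans he.symm)), zero_add, one_smul]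
            rcases Sym2.eq_iff.1 he with ⟨rfl, rfl⟩ | ⟨rfl, rfl⟩
            · exact hγ1
            · rwa [hθ₁.symm]
          · by_cases he' : s(y, a') = s(u, v)
            · rw [if_pos he', if_neg he, add_zero, one_smul]
              rcases Sym2.eq_iff.1 he' with ⟨rfl, rfl⟩ | ⟨rfl, rfl⟩
              · exact hγ2
              · rwa [hθ₁.symm]
            · rw [if_neg he, if_neg he', add_zero, zero_smul, add_zero]
              refine hθ₁ne u v ((hS u v).2 ⟨huv, ?_, hin⟩)
              rw [hQadj]
              rintro (h | h | h)
              · exact hAuv h.2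
              · exact hFuv h
              · exact he h.symm
      · have h5 := h4 u v huv hin
        have hω0 : ω u v = 0 := by
          by_contra h
          have := hFW u v (hFadj.2 h)
          exact hin ⟨mem_union_right _ this.1, mem_union_right _ this.2⟩
        have hθ0 : θ₁ u v = θ u v :=
          hθ₁eq u v (fun h => hin (hQW h).2) (fun h => hin ((hS u v).1 h).2.2)
        simp only [hω0, hcW u v hin, hθ0, zero_smul, add_zero]
        exact h5

/-- A graph has a flow with values in a group of order `16` and exponent two that vanishes on no
edge other than the bridges. -/
theorem exists_flow_ne_zero {V : Type*} [Fintype V] (G : SimpleGraph V) :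
    ∃ φ : V → V → (ZMod 2 × ZMod 2) × (ZMod 2 × ZMod 2), IsFlow G φ ∧
      ∀ u v, G.Adj u v → ¬ G.IsBridge s(u, v) → φ u v ≠ 0 := by
  let H := G.deleteEdges {e | G.IsBridge e}
  have hH : ∀ u v, H.Adj u v → ¬ H.IsBridge s(u, v) := by
    intro u v huv hb
    obtain ⟨hG, hnb⟩ := SimpleGraph.deleteEdges_adj.1 huv
    rw [Set.mem_ofPred_eq, SimpleGraph.isBridge_iff_forall_cycle_notMem hG] at hnb
    push Not at hnb
    obtain ⟨w, c, hc, he⟩ := hnb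
    -- A cycle contains no bridge, so it survives the deletion of all bridges.
    have hcH : ∀ e ∈ c.edges, e ∈ H.edgeSet := by
      intro e he'
      rw [SimpleGraph.edgeSet_deleteEdges]
      exact ⟨c.edges_subset_edgeSet he', fun hb' => hb'.notMem_edges_of_isCycle hc he'⟩
    exact hb.notMem_edges_of_isCycle (hc.transfer hcH) (by rwa [SimpleGraph.Walk.edges_transfer])
  obtain ⟨ψ, θ, h1, h2, -, h3⟩ := exists_flow_pair hH ∅ (by simp)
  have hle : H ≤ G := SimpleGraph.deleteEdges_le _
  refine ⟨fun u v => (ψ u v, θ u v), ⟨fun u v => ?_, fun u v h => ?_, fun u => ?_⟩, ?_⟩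
  · rw [h1.symm, h2.symm]
  · by_contra hn
    apply h
    rw [Prod.mk_eq_zero]
    exact ⟨by_contra fun h' => hn (hle (h1.supp _ _ h')),
      by_contra fun h' => hn (hle (h2.supp _ _ h'))⟩
  · rw [Prod.ext_iff, Prod.fst_sum, Prod.snd_sum]
    exact ⟨h1.sum_eq_zero u, h2.sum_eq_zero u⟩
  · intro u v huv hb h
    rw [Prod.mk_eq_zero] at h
    rcases h3 u v (SimpleGraph.deleteEdges_adj.2 ⟨huv, hb⟩) (by simp) with h' | h'
    · exact h' h.1
    · exact h' h.2

/-! ### From flows to colourings -/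

/-- The fundamental cut of a spanning forest with respect to an edge `xy` consists of the edges
that leave the component of `x` in the forest without `xy`. -/
theorem mem_fundamentalCut_iff {V : Type*} {G T : SimpleGraph V} (hT : IsSpanningForest G T)
    {x y : V} (hxy : T.Adj x y) (e : Sym2 V) :
    e ∈ fundamentalCut G T s(x, y) ↔ ∃ u v, e = s(u, v) ∧ G.Adj u v ∧
      (T.deleteEdges {s(x, y)}).Reachable x u ∧ ¬ (T.deleteEdges {s(x, y)}).Reachable x v := by
  have hb : ¬ (T.deleteEdges {s(x, y)}).Reachable x y :=
    SimpleGraph.isBridge_iff.1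
      (SimpleGraph.isAcyclic_iff_forall_isBridge.1 hT.prop.2 (T.mem_edgeSet.2 hxy))
  constructor
  · rintro ⟨he, x', y', u, v, hf, rfl, hu, hv⟩
    rcases Sym2.eq_iff.1 hf with ⟨rfl, rfl⟩ | ⟨rfl, rfl⟩
    · exact ⟨u, v, rfl, he, hu, fun h => hb (h.trans hv.symm)⟩
    · exact ⟨v, u, Sym2.eq_swap, G.symm.symm _ _ he, hv, fun h => hb (h.trans hu.symm)⟩
  · rintro ⟨u, v, rfl, huv, hu, hv⟩
    refine ⟨huv, x, y, u, v, rfl, rfl, hu, ?_⟩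
    -- Maximality of `T` enters here: the forest connects whatever `G` connects.
    have hTuv : T.Reachable u v := by
      rw [G.reachable_eq_of_maximal_isAcyclic T hT]
      exact huv.reachable
    have hTxv : T.Reachable x v := (hu.mono (SimpleGraph.deleteEdges_le _)).trans hTuv
    by_contra hv'
    obtain ⟨a, ha, b, hb', hab⟩ := hTxv.exists_adj_boundary
      {w | (T.deleteEdges {s(x, y)}).Reachable x w ∨ (T.deleteEdges {s(x, y)}).Reachable y w}
      (Or.inl (SimpleGraph.Reachable.refl _)) (by rintro (h | h); exacts [hv h, hv' h])
    by_cases hs : s(a, b) = s(x, y)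
    · rcases Sym2.eq_iff.1 hs with ⟨-, rfl⟩ | ⟨-, rfl⟩
      · exact hb' (Or.inr (SimpleGraph.Reachable.refl _))
      · exact hb' (Or.inl (SimpleGraph.Reachable.refl _))
    · have hadj : (T.deleteEdges {s(x, y)}).Adj a b := SimpleGraph.deleteEdges_adj.2 ⟨hab, hs⟩
      exact hb' (ha.imp (fun h => h.trans hadj.reachable) fun h => h.trans hadj.reachable)

theorem exists_odd_coloring {V : Type*} [Finite V] {G T : SimpleGraph V}
    (hT : IsSpanningForest G T) :
    ∃ φ : ↥(G.edgeSet \ T.edgeSet) → Fin 16, ∀ f ∈ T.edgeSet, ¬ G.IsBridge f →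
      ∃ i, Odd (Set.ncard {e : ↥(G.edgeSet \ T.edgeSet) |
        (e : Sym2 V) ∈ fundamentalCut G T f ∧ φ e = i}) := by
  classical
  have := Fintype.ofFinite V
  obtain ⟨φ, hφ, hne⟩ := exists_flow_ne_zero G
  let κ : (ZMod 2 × ZMod 2) × (ZMod 2 × ZMod 2) ≃ Fin 16 :=
    Fintype.equivFinOfCardEq (by simp)
  let φ' : Sym2 V → (ZMod 2 × ZMod 2) × (ZMod 2 × ZMod 2) := Sym2.lift ⟨φ, hφ.symm⟩
  refine ⟨fun e => κ (φ' e), fun f hf hfb => ?_⟩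
  induction f with
  | h x y =>
  by_contra hcon
  push Not at hcon
  simp only [Nat.not_odd_iff_even] at hcon
  have hxy : T.Adj x y := hf
  have hb : ¬ (T.deleteEdges {s(x, y)}).Reachable x y :=
    SimpleGraph.isBridge_iff.1
      (SimpleGraph.isAcyclic_iff_forall_isBridge.1 hT.prop.2 (T.mem_edgeSet.2 hxy))
  let S : Finset V := univ.filter fun w => (T.deleteEdges {s(x, y)}).Reachable x w
  have hS : ∀ w, w ∈ S ↔ (T.deleteEdges {s(x, y)}).Reachable x w := fun w => by simp [S]
  have hxS : x ∈ S := (hS x).2 (SimpleGraph.Reachable.refl _)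
  have hyS : y ∉ S := fun h => hb ((hS y).1 h)
  let P : Finset (V × V) := (S ×ˢ Sᶜ).filter fun p => G.Adj p.1 p.2 ∧ ¬ T.Adj p.1 p.2
  have hP : ∀ u v, (u, v) ∈ P ↔ (u ∈ S ∧ v ∉ S) ∧ G.Adj u v ∧ ¬ T.Adj u v := by
    intro u v
    simp [P]
  have hcut := hφ.sum_cut_eq_zero S
  -- The edge `xy` is the only forest edge of the cut, so the non-forest edges must balance its
  -- value.
  have hsum : ∑ p ∈ P, φ p.1 p.2 = φ x y := by
    have hsub : insert (x, y) P ⊆ S ×ˢ Sᶜ := by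
      intro p hp
      rcases mem_insert.1 hp with rfl | hp
      · exact mem_product.2 ⟨hxS, mem_compl.2 hyS⟩
      · exact (mem_filter.1 hp).1
    rw [← sum_subset hsub, sum_insert fun h => ((hP x y).1 h).2.2 hxy] at hcut
    · have h2 := ZModModule.add_self (φ x y)
      exact (add_left_cancel (h2.trans hcut.symm)).symm
    · rintro ⟨u, v⟩ hp hp'
      rw [mem_product, mem_compl] at hp
      by_contra hn
      have huv := hφ.supp u v hn
      rw [mem_insert, not_or, hP] at hp'
      by_cases hTuv : T.Adj u v
      · by_cases hs : s(u, v) = s(x, y)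
        · rcases Sym2.eq_iff.1 hs with ⟨rfl, rfl⟩ | ⟨rfl, rfl⟩
          · exact hp'.1 rfl
          · exact hp.2 hxS
        · have hadj : (T.deleteEdges {s(x, y)}).Adj u v :=
            SimpleGraph.deleteEdges_adj.2 ⟨hTuv, hs⟩
          exact hp.2 ((hS v).2 (((hS u).1 hp.1).trans hadj.reachable))
      · exact hp'.2 ⟨hp, huv, hTuv⟩
  have hcard : ∀ g, Even (P.filter fun p => φ p.1 p.2 = g).card := by
    intro g
    have h := hcon (κ g)
    rw [← Set.ncard_image_of_injective _ Subtype.val_injective] at h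
    have himg : Subtype.val '' {e : ↥(G.edgeSet \ T.edgeSet) |
        (e : Sym2 V) ∈ fundamentalCut G T s(x, y) ∧ κ (φ' e) = κ g} =
        (fun p : V × V => s(p.1, p.2)) '' (P.filter fun p => φ p.1 p.2 = g : Finset (V × V)) := by
      ext e
      constructor
      · rintro ⟨⟨e, he⟩, ⟨hec, heg⟩, rfl⟩
        obtain ⟨u, v, rfl, huv, hu, hv⟩ := (mem_fundamentalCut_iff hT hxy e).1 hec
        refine ⟨(u, v), ?_, rfl⟩
        rw [mem_coe, mem_filter, hP, hS, hS]
        exact ⟨⟨⟨hu, hv⟩, huv, he.2⟩, κ.injective heg⟩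
      · rintro ⟨⟨u, v⟩, hp, rfl⟩
        rw [mem_coe, mem_filter, hP, hS, hS] at hp
        obtain ⟨⟨⟨hu, hv⟩, huv, hTuv⟩, hg⟩ := hp
        exact ⟨⟨s(u, v), huv, hTuv⟩,
          ⟨(mem_fundamentalCut_iff hT hxy _).2 ⟨u, v, rfl, huv, hu, hv⟩, congrArg κ hg⟩, rfl⟩
    rw [himg, Set.InjOn.ncard_image, Set.ncard_coe_finset] at h
    · exact h
    -- Ordering each cut edge from `S` to its complement represents it by exactly one pair.
    · rintro ⟨u, v⟩ hp ⟨u', v'⟩ hp' he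
      rw [mem_coe, mem_filter, hP] at hp hp'
      rcases Sym2.eq_iff.1 he with ⟨h1, h2⟩ | ⟨h1, h2⟩
      · exact Prod.ext h1 h2
      · have h1 : u = v' := h1
        exact absurd (h1 ▸ hp.1.1.1) hp'.1.1.2
  refine hne x y (hT.prop.1 hxy) hfb ?_
  rw [← hsum, ← sum_fiberwise P fun p => φ p.1 p.2]
  refine sum_eq_zero fun g _ => ?_
  rw [sum_congr rfl fun p hp => (mem_filter.1 hp).2, sum_const]
  obtain ⟨m, hm⟩ := hcard g
  rw [hm, add_smul]
  exact ZModModule.add_self _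

/-! ### Complete minors -/

section CliqueModel

variable {V : Type*} {G : SimpleGraph V}

/-- `B` is a family of branch sets of a complete minor of `G`. -/
structure IsCliqueModel (G : SimpleGraph V) {r : ℕ} (B : Fin r → Set V) : Prop where
  connected : ∀ i, (G.induce (B i)).Connected
  disjoint : ∀ i j, i ≠ j → Disjoint (B i) (B j)
  adj : ∀ i j, i ≠ j → ∃ x ∈ B i, ∃ y ∈ B j, G.Adj x y

theorem hasCliqueMinor_iff {t : ℕ} :
    HasCliqueMinor G t ↔ ∃ B : Fin t → Set V, IsCliqueModel G B := by
  constructor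
  · rintro ⟨B, h1, h2, h3⟩
    exact ⟨B, h1, h2, fun i j h => h3 i j h⟩
  · rintro ⟨B, h1, h2, h3⟩
    exact ⟨B, h1, h2, fun i j h => h3 i j h⟩

theorem IsCliqueModel.cons {r : ℕ} {B : Fin r → Set V} (hB : IsCliqueModel G B) {U : Set V}
    (hU : (G.induce U).Connected) (hdisj : ∀ i, Disjoint U (B i))
    (hadj : ∀ i, ∃ x ∈ U, ∃ y ∈ B i, G.Adj x y) :
    IsCliqueModel G (Fin.cons U B : Fin (r + 1) → Set V) where
  connected i := by
    refine Fin.cases ?_ (fun i => ?_) i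
    · exact hU
    · exact hB.connected i
  disjoint i j := by
    refine Fin.cases ?_ (fun i => ?_) i <;> refine Fin.cases ?_ (fun j => ?_) j
    · exact fun h => absurd rfl h
    · intro _
      simpa using hdisj j
    · intro _
      simpa using (hdisj i).symm
    · intro h
      simpa using hB.disjoint i j fun h' => h (by rw [h'])
  adj i j := by
    refine Fin.cases ?_ (fun i => ?_) i <;> refine Fin.cases ?_ (fun j => ?_) j
    · exact fun h => absurd rfl h
    · intro _
      simpa using hadj j
    · intro _
      obtain ⟨x, hx, y, hy, h⟩ := hadj i
      exact ⟨y, by simpa using hy, x, by simpa using hx, h.symm⟩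
    · intro h
      simpa using hB.adj i j fun h' => h (by rw [h'])

theorem isCliqueModel_zero (B : Fin 0 → Set V) : IsCliqueModel G B :=
  ⟨fun i => i.elim0, fun i => i.elim0, fun i => i.elim0⟩

theorem HasCliqueMinor.anti {s t : ℕ} (h : HasCliqueMinor G t) (hst : s ≤ t) :
    HasCliqueMinor G s := by
  obtain ⟨B, hB⟩ := hasCliqueMinor_iff.1 h
  have hinj := Fin.castLE_injective hst
  exact hasCliqueMinor_iff.2 ⟨fun i => B (Fin.castLE hst i), fun i => hB.connected _,
    fun i j h => hB.disjoint _ _ (hinj.ne h), fun i j h => hB.adj _ _ (hinj.ne h)⟩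

theorem HasCliqueMinor.le_card [Fintype V] {t : ℕ} (h : HasCliqueMinor G t) :
    t ≤ Fintype.card V := by
  obtain ⟨B, hB⟩ := hasCliqueMinor_iff.1 h
  have hne : ∀ i, ∃ x, x ∈ B i := fun i => by
    obtain ⟨x⟩ := (hB.connected i).nonempty
    exact ⟨x, x.2⟩
  choose x hx using hne
  have hinj : Function.Injective x := by
    intro i j hij
    by_contra h
    exact Set.disjoint_left.1 (hB.disjoint i j h) (hx i) (hij ▸ hx j)
  simpa using Fintype.card_le_of_injective x hinj

theorem connected_induce_singleton (v : V) : (G.induce {v}).Connected := by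
  have : Nonempty ({v} : Set V) := ⟨⟨v, rfl⟩⟩
  refine ⟨fun a b => ?_⟩
  rw [Subsingleton.elim a b]

/-- An edge that is not a bridge lies on a cycle, which is a triangle minor. -/
theorem hasCliqueMinor_three {u v : V} (huv : G.Adj u v) (h : ¬ G.IsBridge s(u, v)) :
    HasCliqueMinor G 3 := by
  classical
  rw [SimpleGraph.isBridge_iff, not_not] at h
  obtain ⟨p, hp⟩ := h.exists_isPath
  cases p with
  | nil => exact absurd rfl huv.ne
  | @cons _ w _ h1 p =>
    rw [SimpleGraph.Walk.cons_isPath_iff] at hp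
    have hwv : w ≠ v := by
      rintro rfl
      exact (SimpleGraph.deleteEdges_adj.1 h1).2 rfl
    obtain ⟨q, hq⟩ : ∃ q, q = p.reverse := ⟨_, rfl⟩
    have hqp : q.IsPath := hq ▸ hp.1.reverse
    have huq : u ∉ q.support := by rw [hq, SimpleGraph.Walk.support_reverse]; simpa using hp.2
    clear hq hp p
    cases q with
    | nil => exact absurd rfl hwv
    | @cons _ z _ h2 q =>
      rw [SimpleGraph.Walk.cons_isPath_iff] at hqp
      rw [SimpleGraph.Walk.support_cons, List.mem_cons, not_or] at huq
      have hle := SimpleGraph.deleteEdges_le (G := G) {s(u, v)}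
      -- The branch sets are `{u}`, `{v}` and the interior of the path from `u` to `v`; `q` is this
      -- interior, reversed.
      have hconn := (q.mapLe hle).connected_induce_support
      rw [SimpleGraph.Walk.support_mapLe_eq_support] at hconn
      have m1 := (isCliqueModel_zero (G := G) Fin.elim0).cons hconn (fun i => i.elim0)
        (fun i => i.elim0)
      have m2 := m1.cons (connected_induce_singleton v)
        (by
          intro i
          refine Fin.cases ?_ (fun i => i.elim0) i
          simpa using hqp.2)
        (by
          intro i
          refine Fin.cases ?_ (fun i => i.elim0) i
          exact ⟨v, rfl, z, by simp, hle h2⟩)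
      refine hasCliqueMinor_iff.2 ⟨_, m2.cons (connected_induce_singleton u) ?_ ?_⟩
      · intro i
        refine Fin.cases ?_ (fun i => Fin.cases ?_ (fun i => i.elim0) i) i
        · simpa using huv.ne
        · simpa using huq.2
      · intro i
        refine Fin.cases ?_ (fun i => Fin.cases ?_ (fun i => i.elim0) i) i
        · exact ⟨u, rfl, v, by simp, huv⟩
        · exact ⟨u, rfl, w, by simp, hle h1⟩

end CliqueModel

/-! ### Dense graphs have large complete minors -/

section Density

open scoped Classical in
/-- The number of neighbours of `v` in `S`. -/
noncomputable def degreeIn {V : Type*} (G : SimpleGraph V) (S : Finset V) (v : V) : ℕ :=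
  #{w ∈ S | G.Adj v w}

/-- Twice the number of edges inside `S`. -/
noncomputable def degreeSum {V : Type*} (G : SimpleGraph V) (S : Finset V) : ℕ :=
  ∑ v ∈ S, degreeIn G S v

variable {V : Type*} {G : SimpleGraph V}

theorem degreeSum_erase [DecidableEq V] {S : Finset V} {x : V} (hx : x ∈ S) :
    degreeSum G S = degreeSum G (S.erase x) + 2 * degreeIn G S x := by
  classical
  have h1 : ∀ v, degreeIn G S v = degreeIn G (S.erase x) v + if G.Adj x v then 1 else 0 := by
    intro v
    unfold degreeIn
    rw [← insert_erase hx, filter_insert, erase_insert (notMem_erase x S), G.adj_comm x v]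
    split_ifs with h
    · rw [card_insert_of_notMem (by simp)]
    · rw [add_zero]
  unfold degreeSum
  rw [← add_sum_erase S _ hx, sum_congr rfl fun v _ => h1 v, sum_add_distrib]
  have h2 : ∑ v ∈ S.erase x, (if G.Adj x v then 1 else 0) = degreeIn G S x := by
    rw [h1 x, if_neg (G.loopless.irrefl x), add_zero, degreeIn, card_filter]
  rw [h2]
  ring

/-- Mader: a dense graph has a large complete minor. -/
theorem exists_isCliqueModel_of_dense (r : ℕ) (S : Finset V) (hS : S.Nonempty)
    (h : 2 * 2 ^ r * #S ≤ degreeSum G S) :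
    ∃ B : Fin r → Set V, IsCliqueModel G B ∧ ∀ i, B i ⊆ S := by
  classical
  induction r generalizing S with
  | zero => exact ⟨Fin.elim0, isCliqueModel_zero _, fun i => i.elim0⟩
  | succ r ihr =>
  induction hn : #S using Nat.strong_induction_on generalizing S with
  | _ n ih =>
  subst hn
  set m := 2 ^ (r + 1) with hm
  have hmpos : 0 < m := by positivity
  let N : Finset V → Finset V := fun U => {v ∈ S \ U | ∃ u ∈ U, G.Adj u v}
  -- Contracting `U` within `S` leaves `#(S \ U) + 1` vertices; the inequality says that the density
  -- survives.
  let good : Finset V → Prop := fun U => U ⊆ S ∧ (G.induce (U : Set V)).Connected ∧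
    2 * m * (#(S \ U) + 1) ≤ degreeSum G (S \ U) + 2 * #(N U)
  obtain ⟨x, hx⟩ := hS
  have hgood : good {x} := by
    refine ⟨by simpa using hx, by rw [coe_singleton]; exact connected_induce_singleton x, ?_⟩
    have h1 : N {x} = {w ∈ S | G.Adj x w} := by
      ext w
      simp only [N, mem_filter, mem_sdiff, mem_singleton, exists_eq_left]
      exact ⟨fun h => ⟨h.1.1, h.2⟩, fun h => ⟨⟨h.1, h.2.ne'⟩, h.2⟩⟩
    rw [h1, sdiff_singleton_eq_erase, card_erase_add_one hx]
    refine h.trans (degreeSum_erase hx).le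
  obtain ⟨U, hU, hmax⟩ := exists_max_image (S.powerset.filter good) card
    ⟨{x}, mem_filter.2 ⟨mem_powerset.2 hgood.1, hgood⟩⟩
  obtain ⟨hUS, hUc, hUd⟩ := (mem_filter.1 hU).2
  set R := S \ U with hR
  have hUne : U.Nonempty := by
    obtain ⟨u⟩ := hUc.nonempty
    exact ⟨u, u.2⟩
  by_cases hN : (N U).Nonempty
  -- Absorbing `v` into `U` costs one vertex, the edge to `v`, and one edge for each common
  -- neighbour. By maximality this destroys the density, so there are at least `m` common
  -- neighbours.
  · have hdeg : ∀ v ∈ N U, m ≤ degreeIn G (N U) v := by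
      intro v hv
      obtain ⟨hvR, u, hu, huv⟩ := mem_filter.1 hv
      obtain ⟨hvS, hvU⟩ := mem_sdiff.1 hvR
      rw [← hR] at hvR
      have hng : ¬ good (insert v U) := by
        intro hg
        have := hmax _ (mem_filter.2 ⟨mem_powerset.2 hg.1, hg⟩)
        rw [card_insert_of_notMem hvU] at this
        omega
      have hconn : (G.induce (insert v U : Finset V) : SimpleGraph _).Connected := by
        have := SimpleGraph.connected_induce_union (G := G) (s := (U : Set V)) (t := {v})
          hUc.preconnected (connected_induce_singleton v).preconnected hu rfl huv
        rw [coe_insert, Set.insert_eq, Set.union_comm]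
        exact this
      have hlt : ¬ 2 * m * (#(S \ insert v U) + 1) ≤
          degreeSum G (S \ insert v U) + 2 * #(N (insert v U)) :=
        fun h' => hng ⟨insert_subset hvS hUS, hconn, h'⟩
      have hR' : S \ insert v U = R.erase v := by
        ext w
        simp only [hR, mem_sdiff, mem_insert, mem_erase]
        tauto
      have hN' : N (insert v U) = (N U).erase v ∪ {w ∈ R | G.Adj v w} := by
        ext w
        simp only [N, mem_filter, mem_union, mem_erase, hR', ← hR, mem_insert, exists_eq_or_imp]
        constructor
        · rintro ⟨⟨h1, h2⟩, h3 | h3⟩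
          · exact Or.inr ⟨h2, h3⟩
          · exact Or.inl ⟨h1, h2, h3⟩
        · rintro (⟨h1, h2, h3⟩ | ⟨h1, h2⟩)
          · exact ⟨⟨h1, h2⟩, Or.inr h3⟩
          · exact ⟨⟨h2.ne', h1⟩, Or.inl h2⟩
      have hinter : (N U).erase v ∩ {w ∈ R | G.Adj v w} = {w ∈ N U | G.Adj v w} := by
        ext w
        simp only [N, mem_filter, mem_inter, mem_erase, ← hR]
        constructor
        · rintro ⟨⟨h1, h2⟩, h3, h4⟩
          exact ⟨h2, h4⟩
        · rintro ⟨h1, h2⟩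
          exact ⟨⟨h2.ne', h1⟩, h1.1, h2⟩
      have hcard := card_union_add_card_inter ((N U).erase v) {w ∈ R | G.Adj v w}
      rw [← hN', hinter] at hcard
      have e1 := card_erase_add_one hv
      have e2 := card_erase_add_one hvR
      have e3 := degreeSum_erase (G := G) hvR
      rw [hR', e2] at hlt
      change _ + degreeIn G (N U) v = _ + degreeIn G R v at hcard
      rw [mul_add, mul_one] at hUd
      omega
    obtain ⟨B, hB, hBN⟩ := ihr (N U) hN (by
      calc 2 * 2 ^ r * #(N U) = ∑ v ∈ N U, m := by rw [sum_const, smul_eq_mul, hm]; ring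
        _ ≤ degreeSum G (N U) := sum_le_sum hdeg)
    refine ⟨_, hB.cons hUc ?_ ?_, ?_⟩
    · intro i
      refine Set.disjoint_left.2 fun w hw hw' => ?_
      exact (mem_sdiff.1 (mem_filter.1 (hBN i hw')).1).2 hw
    · intro i
      obtain ⟨y⟩ := (hB.connected i).nonempty
      obtain ⟨-, u, hu, huv⟩ := mem_filter.1 (hBN i y.2)
      exact ⟨u, hu, y, y.2, huv⟩
    · intro i
      refine Fin.cases ?_ (fun i => ?_) i
      · simpa using hUS
      · intro w hw
        exact (mem_sdiff.1 (mem_filter.1 (hBN i (by simpa using hw))).1).1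
  -- No edge joins `U` to `R`, so `R` alone is dense, and it is smaller.
  · rw [not_nonempty_iff_eq_empty] at hN
    rw [hN, card_empty, mul_zero, add_zero, mul_add, mul_one] at hUd
    have hRne : R.Nonempty := by
      rw [nonempty_iff_ne_empty]
      intro h0
      rw [h0] at hUd
      simp only [degreeSum, sum_empty, card_empty] at hUd
      omega
    obtain ⟨B, hB, hBR⟩ := ih #R
      (card_lt_card (sdiff_ssubset hUS hUne)) R hRne (by omega) rfl
    exact ⟨B, hB, fun i w hw => (mem_sdiff.1 (hBR i hw)).1⟩

theorem exists_degreeIn_lt {r : ℕ} (h : ¬ HasCliqueMinor G r) (S : Finset V) (hS : S.Nonempty) :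
    ∃ v ∈ S, degreeIn G S v < 2 * 2 ^ r := by
  by_contra! hcon
  obtain ⟨B, hB, -⟩ := exists_isCliqueModel_of_dense (G := G) r S hS (by
    calc 2 * 2 ^ r * #S = ∑ v ∈ S, 2 * 2 ^ r := by rw [sum_const, smul_eq_mul]; ring
      _ ≤ degreeSum G S := sum_le_sum hcon)
  exact h (hasCliqueMinor_iff.2 ⟨B, hB⟩)

end Density

/-! ### Star forests from degeneracy -/

section StarForests

variable {V : Type*} {G : SimpleGraph V}

/-- A graph in which every edge joins a vertex of `L` to its only neighbour, outside `L`, is a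
star forest. -/
theorem isStarForest_of_leaves {F : SimpleGraph V} (L : Set V) (p : V → V)
    (h : ∀ u v, F.Adj u v → (u ∈ L ∧ v ∉ L ∧ p u = v) ∨ (v ∈ L ∧ u ∉ L ∧ p v = u)) :
    IsStarForest F := by
  classical
  have hleaf : ∀ u v, F.Adj u v → u ∈ L → v = p u := by
    intro u v huv hu
    rcases h u v huv with h' | h'
    · exact h'.2.2.symm
    · exact absurd hu h'.2.1
  have hbridge : ∀ u v, F.Adj u v → u ∈ L → ¬ (F.deleteEdges {s(u, v)}).Reachable u v := by
    rintro u v huv hu ⟨q⟩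
    cases q with
    | nil => exact huv.ne rfl
    | cons h1 q =>
      rw [SimpleGraph.deleteEdges_adj] at h1
      rw [hleaf u _ h1.1 hu, ← hleaf u v huv hu] at h1
      exact h1.2 rfl
  constructor
  · rw [SimpleGraph.isAcyclic_iff_forall_isBridge]
    intro e he
    induction e with
    | h u v =>
      rw [SimpleGraph.mem_edgeSet] at he
      rcases h u v he with h' | h'
      · exact SimpleGraph.isBridge_iff.2 (hbridge u v he h'.1)
      · rw [Sym2.eq_swap]
        exact SimpleGraph.isBridge_iff.2 (hbridge v u he.symm h'.1)
  -- The centre of the star of `u`: constant on components and at distance at most one.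
  · let c : V → V := fun u => if u ∈ L ∧ ∃ v, F.Adj u v then p u else u
    have hc : ∀ u v, F.Adj u v → c u = c v := by
      have key : ∀ u v, F.Adj u v → u ∈ L → v ∉ L → c u = c v := by
        intro u v huv hu hv
        simp only [c]
        rw [if_pos ⟨hu, v, huv⟩, if_neg fun h' => hv h'.1, hleaf u v huv hu]
      intro u v huv
      rcases h u v huv with h' | h'
      · exact key u v huv h'.1 h'.2.1
      · exact (key v u huv.symm h'.1 h'.2.1).symm
    have hd : ∀ u, ∃ q : F.Walk u (c u), q.length ≤ 1 := by
      intro u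
      by_cases hu : u ∈ L ∧ ∃ v, F.Adj u v
      · have hcu : c u = p u := if_pos hu
        obtain ⟨hu, v, huv⟩ := hu
        rw [hcu, ← hleaf u v huv hu]
        exact ⟨huv.toWalk, by simp⟩
      · have hcu : c u = u := if_neg hu
        rw [hcu]
        exact ⟨.nil, by simp⟩
    intro u v huv
    have hcuv : c u = c v := by
      obtain ⟨q⟩ := huv
      induction q with
      | nil => rfl
      | cons h1 _ ih => exact (hc _ _ h1).trans ih
    obtain ⟨q, hq⟩ := hd u
    obtain ⟨q', hq'⟩ : ∃ q' : F.Walk v (c u), q'.length ≤ 1 := by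
      rw [hcuv]
      exact hd v
    have := SimpleGraph.dist_le (q.append q'.reverse)
    rw [SimpleGraph.Walk.length_append, SimpleGraph.Walk.length_reverse] at this
    omega

/-- A graph in which every set `S` has a vertex with fewer than `D` neighbours in `S` has a proper
colouring with `D` colours, and an orientation of out-degree at most `D`. -/
theorem exists_coloring_orientation {D : ℕ} (hD : 0 < D)
    (h : ∀ S : Finset V, S.Nonempty → ∃ v ∈ S, degreeIn G S v < D) (S : Finset V) :
    ∃ (c : V → Fin D) (p : Fin D → V → V), ∀ u ∈ S, ∀ v ∈ S, G.Adj u v →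
      c u ≠ c v ∧ ∃ i, p i u = v ∨ p i v = u := by
  classical
  induction hn : #S generalizing S with
  | zero =>
    rw [card_eq_zero] at hn
    subst hn
    exact ⟨fun _ => ⟨0, hD⟩, fun _ v => v, fun u hu => absurd hu (notMem_empty u)⟩
  | succ n ih =>
    obtain ⟨v, hv, hdeg⟩ := h S (card_pos.1 (by omega))
    obtain ⟨c, p, hcp⟩ := ih (S.erase v) (by rw [card_erase_of_mem hv, hn]; rfl)
    set N : Finset V := {w ∈ S | G.Adj v w} with hN
    have hNcard : #N < D := hdeg
    obtain ⟨a, ha⟩ : ∃ a, a ∉ N.image c := by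
      by_contra! hall
      have h1 : #(univ : Finset (Fin D)) ≤ #(N.image c) := card_le_card fun a _ => hall a
      have h2 : #(N.image c) ≤ #N := card_image_le
      rw [card_univ, Fintype.card_fin] at h1
      omega
    -- The out-neighbours of `v` are its fewer than `D` neighbours in `S`, listed in some order; the
    -- default past the end of the list is harmless.
    refine ⟨fun w => if w = v then a else c w,
      fun i w => if w = v then N.toList.getD i v else p i w, ?_⟩
    have key : ∀ w ∈ S, G.Adj v w → a ≠ c w ∧ ∃ i : Fin D, N.toList.getD i v = w := by
      intro w hw hvw
      have hwN : w ∈ N := mem_filter.2 ⟨hw, hvw⟩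
      refine ⟨fun h' => ha (h' ▸ mem_image_of_mem c hwN), ?_⟩
      obtain ⟨i, hi, hiw⟩ := List.getElem_of_mem (mem_toList.2 hwN)
      have hi' : i < #N := by simpa using hi
      exact ⟨⟨i, hi'.trans hNcard⟩, by rw [List.getD_eq_getElem _ _ hi, hiw]⟩
    intro u hu w hw huw
    by_cases h1 : u = v
    · subst h1
      obtain ⟨h2, i, h3⟩ := key w hw huw
      simp only [if_true, if_neg huw.ne']
      exact ⟨h2, i, Or.inl h3⟩
    · by_cases h2 : w = v
      · subst h2
        obtain ⟨h3, i, h4⟩ := key u hu huw.symm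
        simp only [if_true, if_neg huw.ne]
        exact ⟨h3.symm, i, Or.inr h4⟩
      · simp only [if_neg h1, if_neg h2]
        exact hcp u (mem_erase.2 ⟨h1, hu⟩) w (mem_erase.2 ⟨h2, hw⟩) huw

/-- Class `(i, k)` takes edges from a vertex `u` of colour `k` to `p i u`. The colouring is proper,
so the other end is not of colour `k`, and the vertices of colour `k` are leaves. -/
theorem hasStarDecomposition_of_degenerate [Fintype V] {D : ℕ} (hD : 0 < D)
    (h : ∀ S : Finset V, S.Nonempty → ∃ v ∈ S, degreeIn G S v < D) :
    HasStarDecomposition G (D * D) := by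
  obtain ⟨c, p, hcp⟩ := exists_coloring_orientation hD h univ
  have hcls : ∀ e : Sym2 V, ∃ j : Fin (D * D), ∀ u v, e = s(u, v) → G.Adj u v →
      (c u = (finProdFinEquiv.symm j).2 ∧ p (finProdFinEquiv.symm j).1 u = v) ∨
      (c v = (finProdFinEquiv.symm j).2 ∧ p (finProdFinEquiv.symm j).1 v = u) := by
    intro e
    induction e with
    | h a b =>
      by_cases hab : G.Adj a b
      · obtain ⟨-, i, hi⟩ := hcp a (mem_univ a) b (mem_univ b) hab
        obtain ⟨k, hk⟩ : ∃ k, (c a = k ∧ p i a = b) ∨ (c b = k ∧ p i b = a) := by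
          rcases hi with hi | hi
          · exact ⟨c a, Or.inl ⟨rfl, hi⟩⟩
          · exact ⟨c b, Or.inr ⟨rfl, hi⟩⟩
        refine ⟨finProdFinEquiv (i, k), fun u v huv _ => ?_⟩
        rw [Equiv.symm_apply_apply]
        rcases Sym2.eq_iff.1 huv with ⟨rfl, rfl⟩ | ⟨rfl, rfl⟩
        · exact hk
        · exact hk.symm
      · refine ⟨⟨0, Nat.mul_pos hD hD⟩, fun u v huv hadj => absurd ?_ hab⟩
        rcases Sym2.eq_iff.1 huv with ⟨rfl, rfl⟩ | ⟨rfl, rfl⟩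
        · exact hadj
        · exact hadj.symm
  choose cls hcls using hcls
  let F : Fin (D * D) → SimpleGraph V := fun j =>
    { Adj := fun u v => G.Adj u v ∧ cls s(u, v) = j
      symm := ⟨fun u v h => ⟨h.1.symm, by rw [Sym2.eq_swap]; exact h.2⟩⟩
      loopless := ⟨fun u h => h.1.ne rfl⟩ }
  have hF : ∀ j e, e ∈ (F j).edgeSet ↔ e ∈ G.edgeSet ∧ cls e = j := by
    intro j e
    induction e with
    | h u v => rfl
  refine ⟨F, fun j => ?_, fun i j hij => ?_, ?_⟩
  · refine isStarForest_of_leaves {u | c u = (finProdFinEquiv.symm j).2}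
      (p (finProdFinEquiv.symm j).1) ?_
    rintro u v ⟨huv, rfl⟩
    have hne := (hcp u (mem_univ u) v (mem_univ v) huv).1
    rcases hcls s(u, v) u v rfl huv with h' | h'
    · exact Or.inl ⟨h'.1, fun hv => hne (h'.1.trans hv.symm), h'.2⟩
    · exact Or.inr ⟨h'.1, fun hu => hne (hu.trans h'.1.symm), h'.2⟩
  · refine Set.disjoint_left.2 fun e hi hj => hij ?_
    rw [← ((hF i e).1 hi).2, ← ((hF j e).1 hj).2]
  · ext e
    simp only [Set.mem_iUnion, hF]
    exact ⟨fun ⟨_, h⟩ => h.1, fun h => ⟨_, h, rfl⟩⟩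

theorem bddAbove_starArboricityValues (s : ℕ) : BddAbove (starArboricityValues s) := by
  refine ⟨2 * 2 ^ s * (2 * 2 ^ s), ?_⟩
  rintro a ⟨n, G, hG, rfl⟩
  exact Nat.sInf_le (hasStarDecomposition_of_degenerate (by positivity) (exists_degreeIn_lt hG))

theorem one_le_maxStarArboricity {s : ℕ} (hs : 3 ≤ s) : 1 ≤ maxStarArboricity s := by
  have hnm : ¬ HasCliqueMinor (⊤ : SimpleGraph (Fin 2)) s := by
    intro h
    have := h.le_card
    rw [Fintype.card_fin] at this
    omega
  have hmem : starArboricity (⊤ : SimpleGraph (Fin 2)) ∈ starArboricityValues s :=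
    ⟨2, ⊤, hnm, rfl⟩
  refine le_trans ?_ (le_csSup (bddAbove_starArboricityValues s) hmem)
  rw [Nat.one_le_iff_ne_zero]
  intro h0
  -- The infimum of an empty set would also be `0`, so it must be shown to be attained.
  have hdec : HasStarDecomposition (⊤ : SimpleGraph (Fin 2))
      (starArboricity (⊤ : SimpleGraph (Fin 2))) :=
    Nat.sInf_mem (s := {m | HasStarDecomposition (⊤ : SimpleGraph (Fin 2)) m})
      ⟨_, hasStarDecomposition_of_degenerate (by positivity) (exists_degreeIn_lt hnm)⟩
  rw [h0] at hdec
  obtain ⟨F, -, -, hF⟩ := hdec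
  have he : s((0 : Fin 2), 1) ∈ (⊤ : SimpleGraph (Fin 2)).edgeSet := by simp
  rw [← hF, Set.mem_iUnion] at he
  obtain ⟨i, -⟩ := he
  exact i.elim0

end StarForests

end OddCutColoring

/-! ### The two ranges of `t` -/

theorem theorem1p5 (t : ℕ) :
    BddAbove (starArboricityValues (t - 1)) ∧
    ∃ k : ℕ, k ≤ 16 * maxStarArboricity (t - 1) + 1 ∧
      ∀ (V : Type*) [Finite V] (G T : SimpleGraph V),
        ¬ HasCliqueMinor G t → IsSpanningForest G T →
        ∃ φ : ↥(G.edgeSet \ T.edgeSet) → Fin k,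
          ∀ f ∈ T.edgeSet, ¬ G.IsBridge f →
            ∃ i : Fin k,
              Odd (Set.ncard {e : ↥(G.edgeSet \ T.edgeSet) |
                (e : Sym2 V) ∈ fundamentalCut G T f ∧ φ e = i}) := by
  refine ⟨bddAbove_starArboricityValues _, ?_⟩
  by_cases ht : t ≤ 3
  -- Here the summand `+ 1` pays for the single colour, and no edge is a non-bridge.
  · refine ⟨1, by omega, fun V _ G T hG hT => ⟨fun _ => 0, fun f hf hfb => ?_⟩⟩
    induction f with
    | h x y => exact absurd ((hasCliqueMinor_three (hT.prop.1 hf) hfb).anti ht) hG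
  · have hℓ := one_le_maxStarArboricity (s := t - 1) (by omega)
    exact ⟨16, by omega, fun V _ G T _ hT => exists_odd_coloring hT⟩
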